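/- Let $k$ be a field, let $n$ be a natural number and let $A=k[x_1,\dots,x_n]/\langle x_1\cdots x_n\rangle$. Let $A^e=A\otimes_k A^{op}$, and let $$\mathrm{HH}^*(A)=\bigoplus_{m\ge 0}\mathrm{HH}^m(A),\qquad \mathrm{HH}^m(A)=\mathrm{Ext}^m_{A^e}(A,A),$$ be the Hochschild cohomology of $A$, a graded $k$-algebra under the Yoneda product (in which the product $f\smile g$ is the class $f$ followed by the class $g$; if $f,g$ are represented by cocycles on a projective resolution $F_\bullet$ of $A$ over $A^e$, this is $g\circ\tilde f$ with $\tilde f$ a chain map lifting $f$). Let $S=k[X_1,\dots,X_n,Y_1,\dots,Y_n,Z]$ be the graded commutative polynomial ring with $\deg X_i=0$, $\deg Y_i=1$ and $\deg Z=2$, that is, the free associative $k$-algebra on these variables modulo the relations $ab=(-1)^{\deg a\,\deg b}\,ba$ for all variables $a,b$. Let $\mathcal I\subseteq S$ be the two-sided ideal generated by - all products $a_1a_2\cdots a_n$ with $a_i\in\{X_i,Y_i\}$ for each $i$; - the squares $Y_i^2$, for $1\le i\le n$; - for each nonempty subset $I=\{i_1<\dots<i_m\}$ of $\{1,\dots,n\}$,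 the element $$\Bigl(\prod_{j\notin I}X_j\Bigr)\Bigl(\sum_{j=1}^{m}(-1)^{j+1}\,Y_{i_1}\cdots\widehat{Y}_{i_j}\cdots Y_{i_m}\Bigr)Z,$$ where $\widehat{Y}_{i_j}$ means that the factor $Y_{i_j}$ is omitted. Then there is an isomorphism of graded $k$-algebras $\mathrm{HH}^*(A)\cong S/\mathcal I$; it maps $\mathrm{HH}^m(A)$ onto the degree-$m$ component of $S/\mathcal I$ for every $m\ge 0$. -/

import Mathlib

open CategoryTheory CategoryTheory.Abelian
open scoped TensorProduct DirectSum

universe u v w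

noncomputable section

/-! ### The Yoneda algebra of an object in a linear abelian category -/

namespace YonedaAlgebra

variable {C : Type u} [Category.{v} C] [Abelian C] [HasExt.{w} C] (X : C)

/-- The product of two classes, as an element of the disjoint union of the groups `Ext X X n`, does
not depend on how the total degree is written. -/
theorem mk_comp_eq {a b c d : ℕ} (α : Ext X X a) (β : Ext X X b) (h : a + b = c)
    (h' : a + b = d) :
    (GradedMonoid.mk c (α.comp β h) : GradedMonoid fun n : ℕ => Ext X X n) =
      GradedMonoid.mk d (α.comp β h') := by
  subst h; subst h'; rfl

/-- The unit of the Yoneda algebra is the class of the identity. -/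
instance : GradedMonoid.GOne (fun n : ℕ => Ext X X n) where
  one := Ext.mk₀ (𝟙 X)

/-- The Yoneda product on `⨁ n, Ext X X n`: the product of a class `α` with a class `β` is `α`
followed by `β`. -/
instance : GradedMonoid.GMul (fun n : ℕ => Ext X X n) where
  mul {a b} α β := α.comp β (rfl : a + b = a + b)

instance : GradedMonoid.GMonoid (fun n : ℕ => Ext X X n) where
  one_mul := by
    rintro ⟨n, α⟩
    refine (mk_comp_eq X (Ext.mk₀ (𝟙 X)) α _ (zero_add n)).trans ?_
    rw [Ext.mk₀_id_comp]
    rfl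
  mul_one := by
    rintro ⟨n, α⟩
    refine (mk_comp_eq X α (Ext.mk₀ (𝟙 X)) _ (add_zero n)).trans ?_
    rw [Ext.comp_mk₀_id]
    rfl
  mul_assoc := by
    rintro ⟨a, α⟩ ⟨b, β⟩ ⟨c, γ⟩
    refine (congrArg (GradedMonoid.mk (A := fun n : ℕ => Ext X X n) (a + b + c))
      (Ext.comp_assoc α β γ rfl rfl rfl)).trans ?_
    exact mk_comp_eq X α (β.comp γ rfl) _ _

instance : DirectSum.GRing (fun n : ℕ => Ext X X n) where
  mul_zero α := Ext.comp_zero α X _ _ rfl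
  zero_mul β := Ext.zero_comp X _ β _ rfl
  mul_add α β γ := Ext.comp_add α β γ rfl
  add_mul α β γ := Ext.add_comp α β γ rfl
  natCast n := n • Ext.mk₀ (𝟙 X)
  natCast_zero := zero_smul _ _
  natCast_succ n := succ_nsmul _ n
  intCast n := n • Ext.mk₀ (𝟙 X)
  intCast_ofNat n := natCast_zsmul _ n
  intCast_negSucc_ofNat n := negSucc_zsmul _ n

variable (k : Type*) [CommRing k] [Linear k C]

/-- The `k`-algebra structure on `⨁ n, Ext X X n`: a scalar `r` is sent to `r • id` in degree
zero, and the underlying `k`-module is the usual one. -/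
instance : DirectSum.GAlgebra k (fun n : ℕ => Ext X X n) where
  toFun :=
    { toFun := fun r => r • Ext.mk₀ (𝟙 X)
      map_zero' := zero_smul _ _
      map_add' := fun r s => add_smul r s _ }
  map_one := one_smul _ _
  map_mul r s := by
    refine congrArg (GradedMonoid.mk (A := fun n : ℕ => Ext X X n) 0) ?_
    change (r * s) • Ext.mk₀ (𝟙 X) =
      (r • Ext.mk₀ (𝟙 X)).comp (s • Ext.mk₀ (𝟙 X)) (rfl : 0 + 0 = 0)
    rw [Ext.smul_comp, Ext.comp_smul, Ext.mk₀_id_comp, mul_smul]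
  commutes r := by
    rintro ⟨n, α⟩
    refine (mk_comp_eq X (r • Ext.mk₀ (𝟙 X)) α _ (zero_add n)).trans ?_
    refine Eq.trans ?_ (mk_comp_eq X α (r • Ext.mk₀ (𝟙 X)) (add_zero n) _)
    rw [Ext.smul_comp, Ext.comp_smul, Ext.mk₀_id_comp, Ext.comp_mk₀_id]
  smul_def r := by
    rintro ⟨n, α⟩
    refine Eq.trans ?_ (mk_comp_eq X (r • Ext.mk₀ (𝟙 X)) α (zero_add n) _)
    rw [Ext.smul_comp, Ext.mk₀_id_comp]
    rfl

end YonedaAlgebra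

/-! ### Hochschild cohomology of an algebra over a field -/

/-- The algebra `A` as a module over its enveloping algebra `Aᵉ = A ⊗[k] Aᵐᵒᵖ`, with action
`(a ⊗ b) • c = a * c * b`. -/
def regularBimodule (k : Type u) (A : Type v) [Field k] [Ring A] [Algebra k A] :
    ModuleCat.{v} (A ⊗[k] Aᵐᵒᵖ) :=
  letI : Module (A ⊗[k] Aᵐᵒᵖ) A := TensorProduct.Algebra.module
  ModuleCat.of (A ⊗[k] Aᵐᵒᵖ) A

/-- The Hochschild cohomology `HHᵐ(A) = Extᵐ_{Aᵉ}(A, A)` of an algebra over a field. -/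
abbrev HochschildCohomology (k : Type u) (A : Type v) [Field k] [Ring A] [Algebra k A] (m : ℕ) :
    Type v :=
  Ext.{v} (regularBimodule k A) (regularBimodule k A) m

/-- The Hochschild cohomology algebra `HH*(A) = ⨁ m, HHᵐ(A)`, with the Yoneda product. -/
abbrev HochschildCohomologyRing (k : Type u) (A : Type v) [Field k] [Ring A] [Algebra k A] :
    Type v :=
  ⨁ m : ℕ, HochschildCohomology k A m

/-- The homogeneous component of degree `m` of `HH*(A)`. -/
def HochschildCohomologyRing.component (k : Type u) (A : Type v) [Field k] [Ring A]
    [Algebra k A] (m : ℕ) : Submodule k (HochschildCohomologyRing k A) :=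
  LinearMap.range (DirectSum.lof k ℕ (fun m : ℕ => HochschildCohomology k A m) m)

/-! ### The algebra `k[x₁, …, xₙ] / (x₁ ⋯ xₙ)` -/

/-- The ring `k[x₁, …, xₙ] / (x₁ ⋯ xₙ)`. -/
abbrev SquareFreeHypersurface (k : Type u) [Field k] (n : ℕ) : Type u :=
  MvPolynomial (Fin n) k ⧸ Ideal.span {∏ i : Fin n, (MvPolynomial.X i : MvPolynomial (Fin n) k)}

/-! ### The presentation -/

namespace HHPresentation

/-- The variables `X₁, …, Xₙ, Y₁, …, Yₙ, Z`. -/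
inductive Gen (n : ℕ) : Type
  | X (i : Fin n) : Gen n
  | Y (i : Fin n) : Gen n
  | Z : Gen n

/-- The degrees of the variables. -/
def Gen.deg {n : ℕ} : Gen n → ℕ
  | .X _ => 0
  | .Y _ => 1
  | .Z => 2

variable (k : Type u) [Field k] (n : ℕ)

/-- Graded commutativity of the variables: `a b = (-1) ^ (deg a * deg b) b a`. -/
inductive GradedCommRel : FreeAlgebra k (Gen n) → FreeAlgebra k (Gen n) → Prop
  | comm (a b : Gen n) : GradedCommRel (FreeAlgebra.ι k a * FreeAlgebra.ι k b)
      ((-1) ^ (a.deg * b.deg) * (FreeAlgebra.ι k b * FreeAlgebra.ι k a))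

/-- The graded commutative polynomial ring `k[X₁, …, Xₙ, Y₁, …, Yₙ, Z]`. -/
abbrev GradedCommPoly : Type u := RingQuot (GradedCommRel k n)

variable {n}

/-- A variable, as an element of the graded commutative polynomial ring. -/
def var (g : Gen n) : GradedCommPoly k n :=
  RingQuot.mkAlgHom k (GradedCommRel k n) (FreeAlgebra.ι k g)

/-- The element `∏_{i ∈ l} X_i`, the product being taken in the order of the list `l`. -/
def prodX (l : List (Fin n)) : GradedCommPoly k n := (l.map fun i => var k (Gen.X i)).prod

/-- The element `∏_{i ∈ l} Y_i`, the product being taken in the order of the list `l`. -/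
def prodY (l : List (Fin n)) : GradedCommPoly k n := (l.map fun i => var k (Gen.Y i)).prod

variable (n)

/-- The relations `a₁ ⋯ aₙ` with `aᵢ ∈ {Xᵢ, Yᵢ}`. -/
def monomialRelations : Set (GradedCommPoly k n) :=
  {r | ∃ a : Fin n → Gen n, (∀ i, a i = Gen.X i ∨ a i = Gen.Y i) ∧
    r = (List.ofFn fun i => var k (a i)).prod}

/-- The relations `Yᵢ²`. -/
def squareRelations : Set (GradedCommPoly k n) :=
  {r | ∃ i : Fin n, r = var k (Gen.Y i) ^ 2}

/-- The relations
`(∏_{i ∉ I} X_i) (∑_{j = 1}^m (-1)^(j+1) Y_{i_1} ⋯ Ŷ_{i_j} ⋯ Y_{i_m}) Z` for the nonempty subsets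
`I = {i_1 < ⋯ < i_m}` of the index set; here the positions `j` are counted from zero. -/
def boundaryRelations : Set (GradedCommPoly k n) :=
  {r | ∃ I : Finset (Fin n), I.Nonempty ∧
    r = prodX k (Iᶜ.sort (· ≤ ·)) *
      (∑ j ∈ Finset.range I.card, (-1) ^ j * prodY k ((I.sort (· ≤ ·)).eraseIdx j)) *
      var k Gen.Z}

/-- The two-sided ideal generated by the three families of relations. -/
def relationIdeal : TwoSidedIdeal (GradedCommPoly k n) :=
  TwoSidedIdeal.span (monomialRelations k n ∪ squareRelations k n ∪ boundaryRelations k n)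

/-- The quotient of the graded commutative polynomial ring by the ideal of relations. -/
abbrev PresentedAlgebra : Type u := (relationIdeal k n).ringCon.Quotient

/-- The homogeneous component of degree `m` of the quotient: the span of the classes of the
monomials of degree `m` in the variables. -/
def PresentedAlgebra.component (m : ℕ) : Submodule k (PresentedAlgebra k n) :=
  Submodule.span k {r | ∃ w : List (Gen n), (w.map Gen.deg).sum = m ∧
    r = (relationIdeal k n).ringCon.mkₐ k (w.map (var k)).prod}

end HHPresentation

end

/-!
Let `A = k[x₁, …, xₙ] / (x₁ ⋯ xₙ)` and let `B = A ⊗[k] Aᵐᵒᵖ`. With `z_i = x_i ⊗ 1 - 1 ⊗ x_i`, the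
ring `B` is the quotient of the polynomial ring `A[z_1, …, z_n]` over the right tensor factor by
the single nonzerodivisor `f = ∏ (z_i + x_i)`, and `A` is the quotient of `A[z_1, …, z_n]` by the
variables. Since `x_1 ⋯ x_n = 0`, telescoping gives `f = ∑ z_i g_i` with
`g_i = ∏_{j < i} (z_j + x_j) ∏_{j > i} x_j`. So `A` has the Tate resolution over `B`: the exterior
algebra on `e_1, …, e_n` tensored with the divided powers `t^(l)` of a variable of degree two,
with the differential `∑ z_i ι_i + ∑ g_i e_i s`, where `ι_i` is the contraction and `s` is the
shift `t^(l + 1) ↦ t^(l)`. Its exactness (`exists_total_differential_eq`) comes from that of the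
Koszul complex on the variables of a polynomial ring (`exists_koszulD_eq`).

The classes of the presentation are represented by strict chain maps of this resolution: `X_i` by
multiplication with a lift of `x_i`, `Z` by the shift `s`, and `Y_i` by `yOp`, a correction of
`x_i ι_i`. Yoneda products are then compositions (`cls_comp_cocycleClass`), and the product
`Y_I Z^j` is the class of `±x_I` times the coordinate form of `e_I t^(j)` (`prod_yOp`), where
`x_I = ∏_{i ∈ I} x_i`. The coboundary of the coordinate form of `e_I t^(j)` is the alternating sum
over `i ∈ I` of `ĝ_i = ∏_{j ≠ i} x_j` times the coordinate form of `e_{I ∖ i} t^(j + 1)`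
(`cochain_d`); this yields the last family of relations, and the others follow from the product
formula. Thus there is a homomorphism `comparison` from the presented algebra to the Yoneda
algebra.

It is surjective in each degree: if `∑ b_{I,j}` times the coordinate forms is a cocycle, then
reducing modulo `x_i` for `i ∈ I` shows that `ĝ_i b_{I,j}`, hence `b_{I,j}`, is divisible by
`x_i`, so that `b_{I,j}` is a multiple of `x_I` (`exists_coeff_eq`). It is injective: every
element of the presented algebra is a sum of terms `p Y_I Z^j` with `p` a polynomial in the `X_i`
(`exists_normalForm`). If the image is a coboundary, then subtracting a combination of boundary
relations makes all the coefficients `p x_I` vanish in `A`, and then `p` is divisible by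
`∏_{i ∉ I} X_i`, so that `p Y_I Z^j = 0` by the monomial relations (`comparison_injective`).
-/

noncomputable section

/-! ### Classes in Ext groups from a projective resolution -/

/-- A projective resolution of `X` cut into short exact sequences
`0 ⟶ Ω (m + 1) ⟶ F m ⟶ Ω m ⟶ 0` with `F m` projective and `Ω 0 ≅ X`. -/
structure SyzygyChain {C : Type u} [Category.{v} C] [Abelian C] (X : C) where
  /-- the terms of the resolution -/
  F : ℕ → C
  /-- the syzygies -/
  Ω : ℕ → C
  /-- the inclusion of a syzygy -/
  i : ∀ m, Ω (m + 1) ⟶ F m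
  /-- the projection onto a syzygy -/
  p : ∀ m, F m ⟶ Ω m
  zero : ∀ m, i m ≫ p m = 0
  exact : ∀ m, (ShortComplex.mk (i m) (p m) (zero m)).ShortExact
  proj : ∀ m, Projective (F m)
  /-- the augmentation, as an isomorphism -/
  aug : X ≅ Ω 0

namespace SyzygyChain

variable {C : Type u} [Category.{v} C] [Abelian C] [HasExt.{w} C] {X : C} (S : SyzygyChain X)

/-- The class of the `m`-fold extension of `X` by its `m`-th syzygy. -/
def syzygyClass : ∀ m, Ext X (S.Ω m) m
  | 0 => Ext.mk₀ S.aug.hom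
  | m + 1 => (syzygyClass m).comp (S.exact m).extClass rfl

/-- The class in `Ext X Y m` of a morphism from the `m`-th syzygy of `X`, that is, of an
`m`-cocycle on the resolution. -/
def cls {Y : C} {m : ℕ} (f : S.Ω m ⟶ Y) : Ext X Y m :=
  (S.syzygyClass m).comp (Ext.mk₀ f) (add_zero m)

theorem cls_add {Y : C} {m : ℕ} (f g : S.Ω m ⟶ Y) : S.cls (f + g) = S.cls f + S.cls g := by
  simp [cls, Ext.mk₀_add, Ext.comp_add]

theorem cls_smul {k : Type*} [Ring k] [Linear k C] {Y : C} {m : ℕ} (r : k) (f : S.Ω m ⟶ Y) :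
    S.cls (r • f) = r • S.cls f := by
  simp only [cls, Ext.mk₀_smul, Ext.comp_smul]

/-- Dimension shifting: as the terms of the resolution are projective, every class of degree at
least `m` factors through the `m`-fold extension by the `m`-th syzygy. -/
theorem exists_syzygyClass_comp {Y : C} (m b t : ℕ) (h : m + b = t) (α : Ext X Y t) :
    ∃ β : Ext (S.Ω m) Y b, (S.syzygyClass m).comp β h = α := by
  induction m generalizing b with
  | zero =>
    obtain rfl : b = t := by lia
    refine ⟨(Ext.mk₀ S.aug.inv).comp α (zero_add _), ?_⟩
    simp [syzygyClass]
  | succ m ih =>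
    obtain ⟨β, hβ⟩ := ih (1 + b) (by lia)
    have := S.proj m
    have hz : ∀ {t : ℕ} (x : Ext (S.F m) Y t), t = b + 1 → x = 0 := by
      rintro _ x rfl
      exact Ext.eq_zero_of_projective x
    obtain ⟨γ, hγ⟩ := Ext.contravariant_sequence_exact₃ (S.exact m) Y β
      (hz _ (Nat.add_comm 1 b)) rfl
    refine ⟨γ, ?_⟩
    rw [syzygyClass, Ext.comp_assoc _ _ _ _ rfl (by lia), hγ, hβ]

theorem cls_surjective {Y : C} {m : ℕ} (α : Ext X Y m) : ∃ f : S.Ω m ⟶ Y, S.cls f = α := by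
  obtain ⟨β, hβ⟩ := S.exists_syzygyClass_comp m 0 m rfl α
  obtain ⟨f, rfl⟩ := (Ext.mk₀_bijective _ _).surjective β
  exact ⟨f, hβ⟩

theorem eq_zero_of_syzygyClass_comp_eq_zero {Y : C} (m b t : ℕ) (h : m + (b + 1) = t)
    (β : Ext (S.Ω m) Y (b + 1)) (hβ : (S.syzygyClass m).comp β h = 0) : β = 0 := by
  induction m generalizing b with
  | zero =>
    obtain rfl : b + 1 = t := by lia
    have := congrArg (fun γ => (Ext.mk₀ S.aug.inv).comp γ (zero_add _)) hβ
    simpa [syzygyClass] using this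
  | succ m ih =>
    rw [syzygyClass, Ext.comp_assoc (a₂₃ := (b + 1) + 1) _ _ _ _ (by lia) (by lia)] at hβ
    have := S.proj m
    obtain ⟨γ, hγ⟩ := Ext.contravariant_sequence_exact₁ (S.exact m) Y β (by lia) (ih _ _ _ hβ)
    rw [← hγ, Ext.eq_zero_of_projective γ, Ext.comp_zero]

theorem cls_zero_degree_injective {Y : C} (f : S.Ω 0 ⟶ Y) (h : S.cls f = 0) : f = 0 := by
  have := congrArg (fun γ => (Ext.mk₀ S.aug.inv).comp γ (zero_add _)) h
  simpa [cls, syzygyClass, Ext.mk₀_eq_zero_iff] using this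

/-- A cocycle whose class vanishes is a coboundary. -/
theorem exists_of_cls_eq_zero {Y : C} {m : ℕ} (f : S.Ω (m + 1) ⟶ Y) (h : S.cls f = 0) :
    ∃ g : S.F m ⟶ Y, f = S.i m ≫ g := by
  rw [cls, syzygyClass, Ext.comp_assoc (a₂₃ := 1) _ _ _ _ rfl (by lia)] at h
  have h1 := S.eq_zero_of_syzygyClass_comp_eq_zero m 0 _ _ _ h
  obtain ⟨γ, hγ⟩ := Ext.contravariant_sequence_exact₁ (S.exact m) Y _ _ h1
  obtain ⟨g, rfl⟩ := (Ext.mk₀_bijective _ _).surjective γ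
  refine ⟨g, (Ext.mk₀_bijective _ _).injective ?_⟩
  rw [← hγ, Ext.mk₀_comp_mk₀]

/-- The class of a coboundary vanishes. -/
theorem cls_comp_eq_zero {Y : C} {m : ℕ} (g : S.F m ⟶ Y) : S.cls (S.i m ≫ g) = 0 := by
  have : (S.exact m).extClass.comp (Ext.mk₀ (S.i m)) (add_zero 1) = 0 :=
    (S.exact m).extClass_comp
  have h2 : (S.syzygyClass (m + 1)).comp (Ext.mk₀ (S.i m)) (add_zero _) = 0 := by
    rw [syzygyClass, Ext.comp_assoc_of_third_deg_zero, this, Ext.comp_zero]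
  rw [cls, ← Ext.mk₀_comp_mk₀, ← Ext.comp_assoc_of_third_deg_zero, h2, Ext.zero_comp]

/-- The Yoneda product through a chain map `φ` of degree `-a`: the class of the cocycle
`φ 0` followed by the class of a cocycle `f` is the class of `φ b ≫ f`. -/
theorem cls_comp_cls {Y : C} {a b : ℕ} (φ : ∀ j, S.Ω (a + j) ⟶ S.Ω j)
    (ψ : ∀ j, S.F (a + j) ⟶ S.F j) (hi : ∀ j, S.i (a + j) ≫ ψ j = φ (j + 1) ≫ S.i j)
    (hp : ∀ j, S.p (a + j) ≫ φ j = ψ j ≫ S.p j) (f : S.Ω b ⟶ Y) :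
    (S.cls (φ 0 ≫ S.aug.inv)).comp (S.cls f) rfl = S.cls (φ b ≫ f) := by
  have key : ∀ j, (S.cls (φ 0 ≫ S.aug.inv)).comp (S.syzygyClass j) rfl =
      (S.syzygyClass (a + j)).comp (Ext.mk₀ (φ j)) (add_zero _) := by
    intro j
    induction j with
    | zero =>
      change (S.cls (φ 0 ≫ S.aug.inv)).comp (Ext.mk₀ S.aug.hom) (add_zero a) = _
      rw [cls, Ext.comp_assoc_of_third_deg_zero, Ext.mk₀_comp_mk₀]
      simp
    | succ j ih =>
      rw [syzygyClass, ← Ext.comp_assoc _ _ _ rfl rfl rfl, ih]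
      change _ = ((S.syzygyClass (a + j)).comp (S.exact (a + j)).extClass rfl).comp
        (Ext.mk₀ (φ (j + 1))) (add_zero _)
      rw [Ext.comp_assoc_of_third_deg_zero, Ext.comp_assoc_of_second_deg_zero]
      congr 1
      exact (ShortComplex.ShortExact.extClass_naturality (S.exact (a + j)) (S.exact j)
        { τ₁ := φ (j + 1), τ₂ := ψ j, τ₃ := φ j,
          comm₁₂ := (hi j).symm, comm₂₃ := (hp j).symm }).symm
  refine (Ext.comp_assoc_of_third_deg_zero _ _ _ rfl).symm.trans ?_
  rw [key, Ext.comp_assoc_of_third_deg_zero, Ext.mk₀_comp_mk₀, cls]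

end SyzygyChain

/-! ### Contractions and multiplications on the exterior algebra -/

namespace Koszul

variable {n : ℕ}

/-- The sign `(-1)^#{j ∈ I | j < i}` picked up when `e_i` moves to its place in the wedge `e_I`. -/
def sgn (i : Fin n) (I : Finset (Fin n)) : ℤ := (-1) ^ (I.filter (· < i)).card

theorem sgn_mul_self (i : Fin n) (I : Finset (Fin n)) : sgn i I * sgn i I = 1 := by
  rw [sgn, ← mul_pow]; simp

theorem sgn_insert {i j : Fin n} {I : Finset (Fin n)} (h : j ∉ I) :
    sgn i (insert j I) = (if j < i then -1 else 1) * sgn i I := by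
  unfold sgn
  rw [Finset.filter_insert]
  split_ifs with hj
  · rw [Finset.card_insert_of_notMem (by simp [h]), pow_succ, mul_comm]
  · simp

theorem sgn_insert_self (i : Fin n) (I : Finset (Fin n)) : sgn i (insert i I) = sgn i I := by
  unfold sgn
  rw [Finset.filter_insert]
  simp

theorem sgn_erase_self (i : Fin n) (I : Finset (Fin n)) : sgn i (I.erase i) = sgn i I := by
  by_cases h : i ∈ I
  · conv_rhs => rw [← Finset.insert_erase h, sgn_insert_self]
  · rw [Finset.erase_eq_of_notMem h]

theorem sgn_erase {i j : Fin n} {I : Finset (Fin n)} (h : j ∈ I) :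
    sgn i (I.erase j) = (if j < i then -1 else 1) * sgn i I := by
  conv_rhs => rw [← Finset.insert_erase h, sgn_insert (Finset.notMem_erase j I)]
  split_ifs <;> simp [-zsmul_eq_mul]

theorem sgn_swap {i j : Fin n} (h : i ≠ j) :
    (if j < i then (-1 : ℤ) else 1) = -(if i < j then (-1 : ℤ) else 1) := by
  rcases lt_or_gt_of_ne h with h | h <;> simp [h, h.le.not_gt]

variable {B : Type*} [CommRing B]

/-- The contraction of an element `∑ c_I e_I` of the exterior algebra on `e_1, …, e_n` against
the `i`-th dual basis vector. The exterior algebra is encoded by the coefficients `c_I`. -/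
def contr (i : Fin n) : (Finset (Fin n) → B) →ₗ[B] (Finset (Fin n) → B) where
  toFun c I := if i ∈ I then 0 else sgn i I • c (insert i I)
  map_add' c d := by ext I; by_cases h : i ∈ I <;> simp [h, -zsmul_eq_mul]
  map_smul' r c := by ext I; by_cases h : i ∈ I <;> simp [h]; ring

/-- The product `e_i ∧ -` in the exterior algebra. -/
def wedge (i : Fin n) : (Finset (Fin n) → B) →ₗ[B] (Finset (Fin n) → B) where
  toFun c I := if i ∈ I then sgn i I • c (I.erase i) else 0
  map_add' c d := by ext I; by_cases h : i ∈ I <;> simp [h, -zsmul_eq_mul]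
  map_smul' r c := by ext I; by_cases h : i ∈ I <;> simp [h]; ring

theorem contr_apply (i : Fin n) (c : Finset (Fin n) → B) (I : Finset (Fin n)) :
    contr i c I = if i ∈ I then 0 else sgn i I • c (insert i I) := rfl

theorem wedge_apply (i : Fin n) (c : Finset (Fin n) → B) (I : Finset (Fin n)) :
    wedge i c I = if i ∈ I then sgn i I • c (I.erase i) else 0 := rfl

theorem contr_self (i : Fin n) (c : Finset (Fin n) → B) : contr i (contr i c) = 0 := by
  ext I; simp [contr_apply]

theorem wedge_self (i : Fin n) (c : Finset (Fin n) → B) : wedge i (wedge i c) = 0 := by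
  ext I; simp [wedge_apply]

theorem contr_contr (i j : Fin n) (c : Finset (Fin n) → B) :
    contr i (contr j c) = -contr j (contr i c) := by
  by_cases hij : i = j
  · subst hij; simp [contr_self]
  · ext I
    by_cases hi : i ∈ I <;> by_cases hj : j ∈ I <;>
      simp only [contr_apply, Pi.neg_apply, Finset.mem_insert, hi, hj, hij, Ne.symm hij, or_true,
        or_false, if_true, if_false, smul_zero, neg_zero]
    rw [sgn_insert hi, sgn_insert hj, smul_smul, smul_smul, Finset.insert_comm, ← neg_smul]
    congr 1
    rw [sgn_swap hij]; ring

theorem wedge_wedge (i j : Fin n) (c : Finset (Fin n) → B) :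
    wedge i (wedge j c) = -wedge j (wedge i c) := by
  by_cases hij : i = j
  · subst hij; simp [wedge_self]
  · ext I
    by_cases hi : i ∈ I <;> by_cases hj : j ∈ I <;>
      simp only [wedge_apply, Pi.neg_apply, Finset.mem_erase, hi, hj, hij, Ne.symm hij, ne_eq,
        not_false_eq_true, and_true, and_false, if_true, if_false, smul_zero, neg_zero]
    rw [sgn_erase hi, sgn_erase hj, smul_smul, smul_smul, Finset.erase_right_comm, ← neg_smul]
    congr 1
    rw [sgn_swap hij]; ring

theorem contr_wedge_of_ne {i j : Fin n} (hij : i ≠ j) (c : Finset (Fin n) → B) :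
    contr i (wedge j c) = -wedge j (contr i c) := by
  ext I
  by_cases hi : i ∈ I <;> by_cases hj : j ∈ I <;>
    simp only [wedge_apply, contr_apply, Pi.neg_apply, Finset.mem_erase, Finset.mem_insert, hi, hj,
      hij, Ne.symm hij, ne_eq, not_false_eq_true, and_true, or_true, or_false,
      and_false, if_true, if_false, smul_zero, neg_zero]
  rw [sgn_erase hj, sgn_insert hi, smul_smul, smul_smul, Finset.erase_insert_of_ne hij,
    ← neg_smul]
  congr 1
  rw [sgn_swap hij]; ring

theorem contr_wedge_self (i : Fin n) (c : Finset (Fin n) → B) :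
    contr i (wedge i c) + wedge i (contr i c) = c := by
  ext I
  by_cases hi : i ∈ I
  · simp only [Pi.add_apply, contr_apply, wedge_apply, hi, if_true, zero_add, Finset.mem_erase,
      ne_eq, not_true_eq_false, false_and, if_false, Finset.insert_erase hi, sgn_erase_self,
      smul_smul, sgn_mul_self, one_smul]
  · simp only [Pi.add_apply, contr_apply, wedge_apply, hi, if_false, add_zero,
      Finset.mem_insert_self, if_true, sgn_insert_self, smul_smul, sgn_mul_self,
      Finset.erase_insert hi, one_smul]

theorem contr_wedge (i j : Fin n) (c : Finset (Fin n) → B) :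
    contr i (wedge j c) = (if i = j then c else 0) - wedge j (contr i c) := by
  split_ifs with h
  · subst h; rw [eq_sub_iff_add_eq, contr_wedge_self]
  · rw [contr_wedge_of_ne h, zero_sub]

section map

variable {B' : Type*} [CommRing B']

theorem contr_comp (f : B →+ B') (i : Fin n) (c : Finset (Fin n) → B) :
    contr i (f ∘ c) = f ∘ contr i c := by
  ext I; simp only [contr_apply, Function.comp_apply]; split_ifs <;> simp [-zsmul_eq_mul]

theorem wedge_comp (f : B →+ B') (i : Fin n) (c : Finset (Fin n) → B) :
    wedge i (f ∘ c) = f ∘ wedge i c := by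
  ext I; simp only [wedge_apply, Function.comp_apply]; split_ifs <;> simp [-zsmul_eq_mul]

end map

/-- The Koszul differential `∑ z_i ι_i` on the exterior algebra. -/
def koszulD (z : Fin n → B) : (Finset (Fin n) → B) →ₗ[B] (Finset (Fin n) → B) :=
  ∑ i, z i • contr i

/-- The product `(∑ g_i e_i) ∧ -` on the exterior algebra. -/
def wedgeW (g : Fin n → B) : (Finset (Fin n) → B) →ₗ[B] (Finset (Fin n) → B) :=
  ∑ i, g i • wedge i

theorem koszulD_apply (z : Fin n → B) (c : Finset (Fin n) → B) :
    koszulD z c = ∑ i, z i • contr i c := by simp [koszulD]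

theorem wedgeW_apply (g : Fin n → B) (c : Finset (Fin n) → B) :
    wedgeW g c = ∑ i, g i • wedge i c := by simp [wedgeW]

theorem contr_koszulD (z : Fin n → B) (i : Fin n) (c : Finset (Fin n) → B) :
    contr i (koszulD z c) = -koszulD z (contr i c) := by
  simp only [koszulD_apply, map_sum, map_smul, contr_contr i, smul_neg, Finset.sum_neg_distrib]

theorem contr_wedgeW (g : Fin n → B) (i : Fin n) (c : Finset (Fin n) → B) :
    contr i (wedgeW g c) = g i • c - wedgeW g (contr i c) := by
  simp only [wedgeW_apply, map_sum, map_smul, contr_wedge, smul_sub, Finset.sum_sub_distrib,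
    smul_ite, smul_zero, Finset.sum_ite_eq, Finset.mem_univ, if_true]

theorem wedge_wedgeW (g : Fin n → B) (i : Fin n) (c : Finset (Fin n) → B) :
    wedge i (wedgeW g c) = -wedgeW g (wedge i c) := by
  simp only [wedgeW_apply, map_sum, map_smul, wedge_wedge i, smul_neg, Finset.sum_neg_distrib]

theorem koszulD_wedge (z : Fin n → B) (i : Fin n) (c : Finset (Fin n) → B) :
    koszulD z (wedge i c) = z i • c - wedge i (koszulD z c) := by
  simp only [koszulD_apply, map_sum, map_smul, contr_wedge, smul_sub, Finset.sum_sub_distrib,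
    smul_ite, smul_zero, Finset.sum_ite_eq', Finset.mem_univ, if_true]

/-- An element of square zero, in any characteristic: the products of two distinct anticommuting
terms cancel in pairs. -/
theorem sum_smul_eq_zero_of_anticomm {M : Type*} [AddCommGroup M] (a : Fin n → Fin n → M)
    (h0 : ∀ i, a i i = 0) (h : ∀ i j, a i j = -a j i) : ∑ i, ∑ j, a i j = 0 := by
  rw [← Finset.sum_product']
  refine Finset.sum_involution (fun p _ => (p.2, p.1)) ?_ ?_ ?_ ?_
  · rintro ⟨i, j⟩ _
    simp only
    rw [h i j]; simp
  · rintro ⟨i, j⟩ _ hne heq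
    simp only [Prod.mk.injEq] at heq
    exact hne (by simp only; rw [heq.1]; exact h0 _)
  · simp
  · simp

theorem koszulD_koszulD (z : Fin n → B) (c : Finset (Fin n) → B) :
    koszulD z (koszulD z c) = 0 := by
  simp only [koszulD_apply, map_sum, map_smul, Finset.smul_sum]
  refine sum_smul_eq_zero_of_anticomm _ (fun i => by simp [contr_self]) fun i j => ?_
  rw [contr_contr i j, smul_neg, smul_neg, smul_comm, neg_neg]

theorem wedgeW_wedgeW (g h : Fin n → B) (c : Finset (Fin n) → B) :
    wedgeW g (wedgeW h c) = -wedgeW h (wedgeW g c) := by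
  conv_lhs => rw [wedgeW_apply]
  conv_rhs => rw [wedgeW_apply g, map_sum]
  simp only [wedge_wedgeW, map_smul, smul_neg, Finset.sum_neg_distrib]

theorem wedgeW_self (g : Fin n → B) (c : Finset (Fin n) → B) :
    wedgeW g (wedgeW g c) = 0 := by
  simp only [wedgeW_apply, map_sum, map_smul, Finset.smul_sum]
  refine sum_smul_eq_zero_of_anticomm _ (fun i => by simp [wedge_self]) fun i j => ?_
  rw [wedge_wedge i j, smul_neg, smul_neg, smul_comm, neg_neg]

/-- The operators `D = ∑ z_i ι_i` and `W = ∑ g_i e_i` satisfy `D W + W D = ∑ z_i g_i`. -/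
theorem koszulD_wedgeW (z g : Fin n → B) (c : Finset (Fin n) → B) :
    koszulD z (wedgeW g c) = (∑ i, z i * g i) • c - wedgeW g (koszulD z c) := by
  simp only [wedgeW_apply, map_sum, map_smul, koszulD_wedge, smul_sub, Finset.sum_sub_distrib,
    smul_smul, Finset.sum_smul, mul_comm]

theorem koszulD_comp {B' : Type*} [CommRing B'] (f : B →+* B') (z : Fin n → B)
    (c : Finset (Fin n) → B) : koszulD (f ∘ z) (f ∘ c) = f ∘ koszulD z c := by
  ext I
  have := fun i => congrFun (contr_comp (f : B →+ B') i c) I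
  simp only [AddMonoidHom.coe_coe, Function.comp_apply] at this
  simp [koszulD_apply, this]

theorem wedgeW_comp {B' : Type*} [CommRing B'] (f : B →+* B') (z : Fin n → B)
    (c : Finset (Fin n) → B) : wedgeW (f ∘ z) (f ∘ c) = f ∘ wedgeW z c := by
  ext I
  have := fun i => congrFun (wedge_comp (f : B →+ B') i c) I
  simp only [AddMonoidHom.coe_coe, Function.comp_apply] at this
  simp [wedgeW_apply, this]

theorem koszulD_apply_empty (z : Fin n → B) (c : Finset (Fin n) → B) :
    koszulD z c ∅ = ∑ i, z i * c {i} := by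
  simp [koszulD_apply, contr_apply, sgn]

theorem wedgeW_apply_empty (g : Fin n → B) (c : Finset (Fin n) → B) : wedgeW g c ∅ = 0 := by
  simp [wedgeW_apply, wedge_apply]

end Koszul

/-! ### Exactness of Koszul complexes over polynomial rings -/

namespace Koszul

variable {n : ℕ}

section exactness

open MvPolynomial

variable {A : Type*} [CommRing A]

theorem X_mul_divMonomial_of_ne {i j : Fin n} (h : i ≠ j) (p : MvPolynomial (Fin n) A) :
    (X j * p).divMonomial (Finsupp.single i 1) = X j * p.divMonomial (Finsupp.single i 1) := by
  ext m
  rw [coeff_divMonomial, coeff_X_mul', coeff_X_mul', coeff_divMonomial]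
  have : j ∈ (Finsupp.single i 1 + m).support ↔ j ∈ m.support := by
    simp [h]
  simp only [this]
  split_ifs with hj
  · congr 1
    ext l
    simp only [Finsupp.coe_tsub, Finsupp.coe_add, Pi.sub_apply, Pi.add_apply,
      Finsupp.single_apply]
    have : m j ≠ 0 := by simpa using hj
    split_ifs with h1 h2
    · exact absurd (h1.trans h2.symm) h
    · lia
    · lia
    · lia
  · rfl

/-- One step of the contraction of the Koszul complex on the variables of a polynomial ring: a
cycle is homologous to its part without `e_i` and `X_i`. The homotopy is `e_i ∧ -` composed with
the division by `X_i`. -/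
theorem koszulD_sub_wedge_divMonomial (i : Fin n) (c : Finset (Fin n) → MvPolynomial (Fin n) A)
    (hc : koszulD X c = 0) (I : Finset (Fin n)) :
    (c - koszulD X (wedge i fun I => (c I).divMonomial (Finsupp.single i 1))) I =
      if i ∈ I then 0 else (c I).modMonomial (Finsupp.single i 1) := by
  let S : MvPolynomial (Fin n) A →+ MvPolynomial (Fin n) A :=
    { toFun := fun p => p.divMonomial (Finsupp.single i 1)
      map_zero' := zero_divMonomial _
      map_add' := fun p q => add_divMonomial p q _ }
  have hS : ∀ p, X i * S p = p - p.modMonomial (Finsupp.single i 1) := fun p =>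
    eq_sub_of_add_eq (divMonomial_add_modMonomial_single p i)
  have hD : ∀ I, koszulD X (S ∘ c) I =
      -(contr i c I).modMonomial (Finsupp.single i 1) := by
    intro I
    have h1 : ∑ j, S (X j * contr j c I) = 0 := by
      have := congrArg S (congrFun hc I)
      simpa [koszulD_apply] using this
    have h2 : koszulD X (S ∘ c) I = ∑ j, X j * S (contr j c I) := by
      simp [koszulD_apply, contr_comp]
    rw [h2, ← sub_zero (∑ j, _), ← h1, ← Finset.sum_sub_distrib, Finset.sum_eq_single i]
    · rw [hS]
      have : S (X i * contr i c I) = contr i c I := X_mul_divMonomial _ _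
      rw [this]; ring
    · intro j _ hj
      have : S (X j * contr j c I) = X j * S (contr j c I) := X_mul_divMonomial_of_ne hj.symm _
      rw [this, sub_self]
    · simp
  change (c - koszulD X (wedge i (S ∘ c))) I = _
  rw [koszulD_wedge, Pi.sub_apply, Pi.sub_apply, Pi.smul_apply, smul_eq_mul, Function.comp_apply,
    hS, wedge_apply, hD]
  split_ifs with hi
  · rw [contr_apply, if_neg (Finset.notMem_erase i I), Finset.insert_erase hi, sgn_erase_self]
    have : ∀ p : MvPolynomial (Fin n) A, (sgn i I • p).modMonomial (Finsupp.single i 1) =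
        sgn i I • p.modMonomial (Finsupp.single i 1) := by
      intro p
      have h1 := hS (sgn i I • p)
      rw [map_zsmul, mul_smul_comm, hS, smul_sub] at h1
      exact (sub_right_injective h1).symm
    rw [this, smul_neg, smul_smul, sgn_mul_self, one_smul]
    ring
  · ring

/-- The Koszul complex on the variables of a polynomial ring over `A` is a resolution of `A`. -/
theorem exists_koszulD_eq (c : Finset (Fin n) → MvPolynomial (Fin n) A)
    (hc : koszulD X c = 0) (h0 : constantCoeff (c ∅) = 0) : ∃ b, koszulD X b = c := by
  -- The variables are removed one by one: after the step for `i`, neither `e_i` nor `X_i` occurs.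
  have key : ∀ T : Finset (Fin n), ∃ b : Finset (Fin n) → MvPolynomial (Fin n) A,
      ∀ I m, (∃ i ∈ T, i ∈ I ∨ m i ≠ 0) → coeff m ((c - koszulD X b) I) = 0 := by
    intro T
    induction T using Finset.induction_on with
    | empty => exact ⟨0, by simp⟩
    | insert i T _ ih =>
      obtain ⟨b, hb⟩ := ih
      have hc' : koszulD X (c - koszulD X b) = 0 := by
        rw [map_sub, hc, koszulD_koszulD, sub_zero]
      refine ⟨b + wedge i fun I => ((c - koszulD X b) I).divMonomial (Finsupp.single i 1), ?_⟩
      intro I m hIm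
      rw [map_add, ← sub_sub, koszulD_sub_wedge_divMonomial i _ hc']
      split_ifs with hi
      · simp
      · by_cases hm : m i = 0
        · rw [coeff_modMonomial_of_not_le _ (by simp [hm])]
          refine hb I m ?_
          obtain ⟨j, hj, hj'⟩ := hIm
          rcases Finset.mem_insert.mp hj with rfl | hj
          · exact absurd hj' (by simp [hi, hm])
          · exact ⟨j, hj, hj'⟩
        · rw [coeff_modMonomial_of_le]
          simpa [Nat.one_le_iff_ne_zero] using hm
  obtain ⟨b, hb⟩ := key Finset.univ
  refine ⟨b, (sub_eq_zero.mp ?_).symm⟩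
  ext I m
  rw [Pi.zero_apply, coeff_zero]
  by_cases h : ∃ i ∈ Finset.univ, i ∈ I ∨ m i ≠ 0
  · exact hb I m h
  · push Not at h
    obtain rfl : I = ∅ := Finset.eq_empty_of_forall_notMem fun i => (h i (Finset.mem_univ i)).1
    obtain rfl : m = 0 := Finsupp.ext fun i => (h i (Finset.mem_univ i)).2
    have h1 : coeff 0 (koszulD X b ∅) = 0 := by
      rw [koszulD_apply_empty]
      change constantCoeff _ = 0
      simp
    have h2 : coeff 0 (c ∅) = 0 := h0
    rw [Pi.sub_apply, coeff_sub, h1, h2, sub_zero]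

end exactness

section hypersurface

variable {R : Type*} [CommRing R] {Q : Type*} [CommRing Q]

/-- Exactness of the total differential `D + W s` over a hypersurface quotient `Q = R / (f)`, where
`f = ∑ z_i g_i` is a nonzerodivisor: an element `c` of the total complex has the components
`c l`, the coefficients of the divided powers of a variable of degree two. If `c` lifts a cycle
to `R` and `v` is the resulting error, `D (c l) + W (c (l + 1)) = f • v l`, then `D W + W D = f`
gives `c (l + 1) = D (v l) + W (v (l + 1))`, so only the component `c 0` needs the exactness of the
Koszul complex over `R`. -/
theorem exists_total_differential_eq (q : R →+* Q) (hq : Function.Surjective q)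
    (z g : Fin n → R) (hf : ∀ r, q r = 0 → (∑ i, z i * g i) ∣ r)
    (hf0 : ∀ r, (∑ i, z i * g i) * r = 0 → r = 0)
    {A : Type*} [Zero A] (ε : Q → A)
    (hK : ∀ c : Finset (Fin n) → R, koszulD z c = 0 → ε (q (c ∅)) = 0 → ∃ b, koszulD z b = c)
    (c : ℕ → Finset (Fin n) → Q)
    (hc : ∀ l, koszulD (q ∘ z) (c l) + wedgeW (q ∘ g) (c (l + 1)) = 0)
    (h0 : ε (c 0 ∅) = 0) :
    ∃ b : ℕ → Finset (Fin n) → Q,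
      ∀ l, koszulD (q ∘ z) (b l) + wedgeW (q ∘ g) (b (l + 1)) = c l := by
  set f := ∑ i, z i * g i with hfdef
  choose c' hc' using fun l => fun I => hq (c l I)
  have hcc : ∀ l, q ∘ c' l = c l := fun l => funext (hc' l)
  have hv : ∀ l, ∃ v : Finset (Fin n) → R,
      koszulD z (c' l) + wedgeW g (c' (l + 1)) = f • v := by
    intro l
    have h1 : ∀ I, q ((koszulD z (c' l) + wedgeW g (c' (l + 1))) I) = 0 := by
      intro I
      have := congrFun (hc l) I
      rw [← hcc, ← hcc, koszulD_comp, wedgeW_comp] at this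
      simpa using this
    choose v hv using fun I => hf _ (h1 I)
    exact ⟨v, funext hv⟩
  choose v hv using hv
  have cancel : ∀ a b : Finset (Fin n) → R, f • a = f • b → a = b := by
    intro a b h
    ext I
    refine sub_eq_zero.mp (hf0 _ ?_)
    have := congrFun h I
    simp only [Pi.smul_apply, smul_eq_mul] at this
    rw [mul_sub, this, sub_self]
  have hsucc : ∀ l, c' (l + 1) = koszulD z (v l) + wedgeW g (v (l + 1)) := by
    intro l
    apply cancel
    have h1 := congrArg (koszulD z) (hv l)
    rw [map_add, koszulD_koszulD, zero_add, map_smul, koszulD_wedgeW, ← hfdef,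
      eq_sub_of_add_eq (hv (l + 1)), map_sub, wedgeW_self, sub_zero, map_smul] at h1
    rw [smul_add, ← h1]
    abel
  have hcyc : koszulD z (c' 0 - wedgeW g (v 0)) = 0 := by
    rw [map_sub, koszulD_wedgeW, ← hfdef, ← hv 0, hsucc 0, map_add, wedgeW_self]
    abel
  obtain ⟨b, hb⟩ := hK _ hcyc (by
    rw [Pi.sub_apply, wedgeW_apply_empty, sub_zero, hc', h0])
  refine ⟨fun l => q ∘ (Nat.casesOn l b v : Finset (Fin n) → R), fun l => ?_⟩
  rw [koszulD_comp, wedgeW_comp, ← hcc]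
  ext I
  simp only [Pi.add_apply, Function.comp_apply, ← map_add]
  congr 1
  cases l with
  | zero =>
    have := congrFun hb I
    simp only [Pi.sub_apply] at this
    exact eq_sub_iff_add_eq.mp this
  | succ l => exact (congrFun (hsucc l) I).symm

end hypersurface

end Koszul

/-! ### The Tate resolution and its chain maps -/

namespace Koszul

variable {n : ℕ}

/-- The total complex, with all degrees taken together: `c l I` is the coefficient of `e_I t^(l)`,
where `e_1, …, e_n` are exterior variables of degree one and `t^(l)` is the `l`-th divided power of
a variable of degree two. -/
abbrev Tot (n : ℕ) (B : Type*) := ℕ → Finset (Fin n) → B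

variable {B : Type u} [CommRing B]

/-- The part of degree `m` of the total complex. -/
def degPart (n : ℕ) (B : Type u) [CommRing B] (m : ℕ) : Submodule B (Tot n B) where
  carrier := {c | ∀ l I, I.card + 2 * l ≠ m → c l I = 0}
  add_mem' hc hd l I h := by simp [hc l I h, hd l I h]
  zero_mem' l I _ := rfl
  smul_mem' r c hc l I h := by simp [hc l I h]

/-- The projection of the total complex onto its part of degree `m`. -/
def degProj (m : ℕ) : Tot n B →ₗ[B] degPart n B m where
  toFun c := ⟨fun l I => if I.card + 2 * l = m then c l I else 0, fun l I h => if_neg h⟩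
  map_add' c d := by
    ext l I; by_cases h : I.card + 2 * l = m <;> simp [h]
  map_smul' r c := by
    ext l I; by_cases h : I.card + 2 * l = m <;> simp [h]

theorem degProj_apply (m : ℕ) (c : Tot n B) (l : ℕ) (I : Finset (Fin n)) :
    (degProj m c : Tot n B) l I = if I.card + 2 * l = m then c l I else 0 := rfl

theorem degProj_of_mem {m : ℕ} {c : Tot n B} (hc : c ∈ degPart n B m) :
    (degProj m c : Tot n B) = c := by
  ext l I
  rw [degProj_apply]
  split_ifs with h
  · rfl
  · exact (hc l I h).symm

/-- The indices of the basis vectors of degree `m`. -/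
abbrev DegIndex (n m : ℕ) := {p : Finset (Fin n) × Fin (m + 1) // p.1.card + 2 * p.2 = m}

/-- The part of degree `m` is free of finite rank. -/
def degPartEquiv (m : ℕ) : degPart n B m ≃ₗ[B] (DegIndex n m → B) where
  toFun c p := c.1 p.1.2 p.1.1
  invFun x := ⟨fun l I => if h : I.card + 2 * l = m then x ⟨(I, ⟨l, by lia⟩), h⟩ else 0,
    fun l I h => dif_neg h⟩
  map_add' c d := rfl
  map_smul' r c := rfl
  left_inv c := by
    ext l I
    by_cases h : I.card + 2 * l = m
    · simp [h]
    · simp [h, c.2 l I h]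
  right_inv x := by
    ext ⟨⟨I, l, hl⟩, h⟩
    simp only at h
    simp [h]

instance (m : ℕ) : Module.Projective B (degPart n B m) :=
  Module.Projective.of_equiv (degPartEquiv m).symm

/-- The differential `D + W s` of the total complex, with `s` the shift `t^(l + 1) ↦ t^(l)`. -/
def totD (z g : Fin n → B) : Tot n B →ₗ[B] Tot n B where
  toFun c l := koszulD z (c l) + wedgeW g (c (l + 1))
  map_add' c d := by ext l I; simp; ring
  map_smul' r c := by ext l I; simp; ring

theorem totD_apply (z g : Fin n → B) (c : Tot n B) (l : ℕ) :
    totD z g c l = koszulD z (c l) + wedgeW g (c (l + 1)) := rfl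

theorem contr_eq_zero_of_degree {m : ℕ} {c : Tot n B} (hc : c ∈ degPart n B (m + 1)) (i : Fin n)
    (l : ℕ) (I : Finset (Fin n)) (h : I.card + 2 * l ≠ m) : contr i (c l) I = 0 := by
  rw [contr_apply]
  split_ifs with hi
  · rfl
  · rw [hc, smul_zero]
    rw [Finset.card_insert_of_notMem hi]; lia

theorem wedge_eq_zero_of_degree {m : ℕ} {c : Tot n B} (hc : c ∈ degPart n B (m + 1)) (i : Fin n)
    (l : ℕ) (I : Finset (Fin n)) (h : I.card + 2 * l ≠ m) : wedge i (c (l + 1)) I = 0 := by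
  rw [wedge_apply]
  split_ifs with hi
  · rw [hc, smul_zero]
    have := Finset.card_erase_add_one hi
    lia
  · rfl

theorem totD_mem (z g : Fin n → B) {m : ℕ} {c : Tot n B} (hc : c ∈ degPart n B (m + 1)) :
    totD z g c ∈ degPart n B m := by
  intro l I h
  rw [totD_apply, Pi.add_apply, koszulD_apply, wedgeW_apply]
  simp [contr_eq_zero_of_degree hc _ l I h, wedge_eq_zero_of_degree hc _ l I h]

theorem totD_totD (z g : Fin n → B) (h : ∑ i, z i * g i = 0) (c : Tot n B) :
    totD z g (totD z g c) = 0 := by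
  ext l : 1
  simp only [totD_apply, map_add, koszulD_koszulD, koszulD_wedgeW, h, wedgeW_self, zero_smul,
    Pi.zero_apply]
  abel

/-- The total differential is homogeneous of degree `-1`. -/
theorem totD_degProj (z g : Fin n → B) (m : ℕ) (c : Tot n B) :
    totD z g (degProj (m + 1) c : Tot n B) = degProj m (totD z g c) := by
  have h : c = (degProj (m + 1) c : Tot n B) + (c - (degProj (m + 1) c : Tot n B)) := by abel
  have h2 : (degProj m (totD z g (c - (degProj (m + 1) c : Tot n B))) : Tot n B) = 0 := by
    ext l I
    rw [degProj_apply]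
    split_ifs with hI
    · have h3 : ∀ l' J, J.card + 2 * l' = m + 1 →
          (c - (degProj (m + 1) c : Tot n B)) l' J = 0 := by
        intro l' J hJ
        rw [Pi.sub_apply, Pi.sub_apply, degProj_apply, if_pos hJ, sub_self]
      rw [totD_apply, Pi.add_apply, koszulD_apply, wedgeW_apply]
      have h4 : ∀ i, contr i ((c - (degProj (m + 1) c : Tot n B)) l) I = 0 := by
        intro i
        rw [contr_apply]
        split_ifs with hi
        · rfl
        · rw [h3 _ _ (by rw [Finset.card_insert_of_notMem hi]; lia), smul_zero]
      have h5 : ∀ i, wedge i ((c - (degProj (m + 1) c : Tot n B)) (l + 1)) I = 0 := by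
        intro i
        rw [wedge_apply]
        split_ifs with hi
        · have := Finset.card_erase_add_one hi
          rw [h3 _ _ (by lia), smul_zero]
        · rfl
      simp only [Finset.sum_apply, Pi.smul_apply, h4, h5, smul_zero, Finset.sum_const_zero,
        add_zero, Pi.zero_apply]
    · rfl
  conv_rhs => rw [h, map_add, map_add, Submodule.coe_add, h2, add_zero]
  rw [degProj_of_mem (totD_mem z g (degProj (m + 1) c).2)]

/-- The augmentation of the total complex, with values in a quotient `A` of `B`. -/
def aug (A : Type*) [CommRing A] [Algebra B A] : Tot n B →ₗ[B] A where
  toFun c := algebraMap B A (c 0 ∅)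
  map_add' c d := by simp
  map_smul' r c := by simp [Algebra.smul_def]

theorem aug_apply (A : Type*) [CommRing A] [Algebra B A] (c : Tot n B) :
    aug A c = algebraMap B A (c 0 ∅) := rfl

/-- The data which determine the Tate resolution of a quotient `A` of `B` by elements `z_i`:
a relation `∑ z_i g_i = 0` such that the total complex with the differential
`∑ z_i ι_i + ∑ g_i e_i s` is exact away from the augmentation to `A`. -/
structure TateData (n : ℕ) (B A : Type u) [CommRing B] [CommRing A] [Algebra B A] where
  /-- the elements killed by the variables of degree one -/
  z : Fin n → B
  /-- the coefficients of the cycle killed by the variable of degree two -/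
  g : Fin n → B
  sum_mul_eq_zero : ∑ i, z i * g i = 0
  algebraMap_z : ∀ i, algebraMap B A (z i) = 0
  surjective : Function.Surjective (algebraMap B A)
  exact : ∀ c : Tot n B, totD z g c = 0 → algebraMap B A (c 0 ∅) = 0 → ∃ b, totD z g b = c

namespace TateData

variable {A : Type u} [CommRing A] [Algebra B A] (T : TateData n B A)

/-- The differential of the Tate resolution. -/
def d : Tot n B →ₗ[B] Tot n B := totD T.z T.g

theorem d_apply (c : Tot n B) (l : ℕ) :
    T.d c l = koszulD T.z (c l) + wedgeW T.g (c (l + 1)) := rfl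

theorem d_d (c : Tot n B) : T.d (T.d c) = 0 := totD_totD _ _ T.sum_mul_eq_zero c

theorem d_mem {m : ℕ} {c : Tot n B} (hc : c ∈ degPart n B (m + 1)) : T.d c ∈ degPart n B m :=
  totD_mem _ _ hc

/-- The differential in degree `m + 1`. -/
def dDeg (m : ℕ) : degPart n B (m + 1) →ₗ[B] degPart n B m :=
  T.d.restrict fun _ hc => T.d_mem hc

theorem dDeg_coe {m : ℕ} (c : degPart n B (m + 1)) : (T.dDeg m c : Tot n B) = T.d c := rfl

theorem aug_d (c : Tot n B) : aug A (T.d c) = 0 := by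
  rw [aug_apply, d_apply, Pi.add_apply, wedgeW_apply_empty, koszulD_apply_empty]
  simp [T.algebraMap_z]

theorem exists_dDeg_eq {m : ℕ} (c : degPart n B m) (hc : T.d c = 0)
    (h0 : aug A (c : Tot n B) = 0) :
    ∃ b, T.dDeg m b = c := by
  obtain ⟨b, hb⟩ := T.exact c hc h0
  refine ⟨degProj (m + 1) b, Subtype.ext ?_⟩
  rw [dDeg_coe, d, totD_degProj, hb, degProj_of_mem c.2]

/-- The `m`-th syzygy of the Tate resolution, as the cokernel of the differential. -/
abbrev syzygy (m : ℕ) := degPart n B m ⧸ LinearMap.range (T.dDeg m)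

/-- The inclusion of a syzygy into the preceding term. -/
def syzygyIncl (m : ℕ) : T.syzygy (m + 1) →ₗ[B] degPart n B m :=
  Submodule.liftQ _ (T.dDeg m) (by
    rintro _ ⟨c, rfl⟩
    exact Subtype.ext (T.d_d c))

theorem syzygyIncl_injective (m : ℕ) : Function.Injective (T.syzygyIncl m) := by
  rw [injective_iff_map_eq_zero]
  intro x hx
  obtain ⟨c, rfl⟩ := Submodule.Quotient.mk_surjective _ x
  rw [Submodule.Quotient.mk_eq_zero]
  refine T.exists_dDeg_eq c (congrArg Subtype.val hx) ?_
  rw [aug_apply, c.2 0 ∅ (by simp), map_zero]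

/-- The augmentation, as an isomorphism from the zeroth syzygy. -/
def syzygyZeroEquiv : T.syzygy 0 ≃ₗ[B] A :=
  LinearEquiv.ofBijective
    (Submodule.liftQ _ (aug A ∘ₗ (degPart n B 0).subtype) (by
      rintro _ ⟨c, rfl⟩
      exact T.aug_d c))
    ⟨by
      rw [injective_iff_map_eq_zero]
      intro x hx
      obtain ⟨c, rfl⟩ := Submodule.Quotient.mk_surjective _ x
      rw [Submodule.Quotient.mk_eq_zero]
      refine T.exists_dDeg_eq c ?_ hx
      ext l I
      rw [d_apply, Pi.add_apply, koszulD_apply, wedgeW_apply]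
      have h1 : ∀ i, contr i (c.1 l) I = 0 := by
        intro i
        rw [contr_apply]
        split_ifs with hi
        · rfl
        · rw [c.2 _ _ (by rw [Finset.card_insert_of_notMem hi]; lia), smul_zero]
      have h2 : ∀ i, wedge i (c.1 (l + 1)) I = 0 := by
        intro i
        rw [wedge_apply]
        split_ifs with hi
        · rw [c.2 _ _ (by lia), smul_zero]
        · rfl
      simp [h1, h2], by
      intro a
      obtain ⟨b, rfl⟩ := T.surjective a
      refine ⟨Submodule.Quotient.mk ⟨fun l I => if I.card + 2 * l = 0 then b else 0,
        fun l I h => if_neg h⟩, ?_⟩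
      change algebraMap B A (if (∅ : Finset (Fin n)).card + 2 * 0 = 0 then b else 0) = _
      simp⟩

/-- The Tate resolution, cut into short exact sequences. -/
def chain : SyzygyChain (ModuleCat.of B A) where
  F m := ModuleCat.of B (degPart n B m)
  Ω m := ModuleCat.of B (T.syzygy m)
  i m := ModuleCat.ofHom (T.syzygyIncl m)
  p m := ModuleCat.ofHom (Submodule.mkQ _)
  zero m := by
    refine ModuleCat.hom_ext (Submodule.linearMap_qext _ (LinearMap.ext fun c => ?_))
    exact (Submodule.Quotient.mk_eq_zero _).mpr ⟨c, rfl⟩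
  exact m :=
    { exact := by
        rw [ShortComplex.moduleCat_exact_iff]
        intro x hx
        obtain ⟨c, hc⟩ := (Submodule.Quotient.mk_eq_zero _).mp hx
        exact ⟨Submodule.Quotient.mk c, hc⟩
      mono_f := (ModuleCat.mono_iff_injective _).mpr (T.syzygyIncl_injective m)
      epi_g := (ModuleCat.epi_iff_surjective _).mpr (Submodule.mkQ_surjective _) }
  proj m := (IsProjective.iff_projective _).mp inferInstance
  aug := T.syzygyZeroEquiv.symm.toModuleIso

/-- A linear form on the total complex is an `m`-cocycle if it vanishes on the boundaries in
degree `m`. -/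
def IsCocycle (m : ℕ) (γ : Tot n B →ₗ[B] A) : Prop := ∀ c ∈ degPart n B (m + 1), γ (T.d c) = 0

variable {T} in
/-- The morphism from the `m`-th syzygy which is given by an `m`-cocycle. -/
def IsCocycle.hom {m : ℕ} {γ : Tot n B →ₗ[B] A} (h : T.IsCocycle m γ) :
    T.chain.Ω m ⟶ ModuleCat.of B A :=
  ModuleCat.ofHom (Submodule.liftQ _ (γ ∘ₗ (degPart n B m).subtype) (by
    rintro _ ⟨c, rfl⟩
    exact h c c.2))

/-- The class of an `m`-cocycle. -/
def cocycleClass {m : ℕ} {γ : Tot n B →ₗ[B] A} (h : T.IsCocycle m γ) :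
    Ext.{u} (ModuleCat.of B A) (ModuleCat.of B A) m :=
  T.chain.cls h.hom

variable {T} {m : ℕ}

theorem cocycleClass_congr {γ γ' : Tot n B →ₗ[B] A} (h : T.IsCocycle m γ) (h' : T.IsCocycle m γ')
    (hγ : ∀ c ∈ degPart n B m, γ c = γ' c) : T.cocycleClass h = T.cocycleClass h' := by
  have : h.hom = h'.hom := by
    refine ModuleCat.hom_ext (Submodule.linearMap_qext _ ?_)
    ext c
    exact hγ c c.2
  rw [cocycleClass, this, cocycleClass]

theorem IsCocycle.add {γ γ' : Tot n B →ₗ[B] A} (h : T.IsCocycle m γ) (h' : T.IsCocycle m γ') :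
    T.IsCocycle m (γ + γ') := fun c hc => by simp [h c hc, h' c hc]

theorem cocycleClass_add {γ γ' : Tot n B →ₗ[B] A} (h : T.IsCocycle m γ) (h' : T.IsCocycle m γ') :
    T.cocycleClass (h.add h') = T.cocycleClass h + T.cocycleClass h' := by
  rw [cocycleClass, cocycleClass, cocycleClass, ← SyzygyChain.cls_add]
  congr 1
  refine ModuleCat.hom_ext (Submodule.linearMap_qext _ ?_)
  ext c
  rfl

theorem isCocycle_zero : T.IsCocycle m (0 : Tot n B →ₗ[B] A) := fun _ _ => rfl

theorem cocycleClass_zero : T.cocycleClass (isCocycle_zero (T := T) (m := m)) = 0 := by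
  have := cocycleClass_add (isCocycle_zero (T := T) (m := m)) isCocycle_zero
  rw [cocycleClass_congr (isCocycle_zero.add isCocycle_zero) isCocycle_zero (by simp)] at this
  exact left_eq_add.mp this

theorem exists_cocycleClass_eq (α : Ext.{u} (ModuleCat.of B A) (ModuleCat.of B A) m) :
    ∃ (γ : Tot n B →ₗ[B] A) (h : T.IsCocycle m γ), T.cocycleClass h = α := by
  obtain ⟨f, rfl⟩ := T.chain.cls_surjective α
  let γ : Tot n B →ₗ[B] A := f.hom ∘ₗ Submodule.mkQ _ ∘ₗ degProj m
  have h : T.IsCocycle m γ := by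
    intro c hc
    have h1 : degProj m (T.d c) = T.dDeg m ⟨c, hc⟩ :=
      Subtype.ext (degProj_of_mem (T.d_mem hc))
    change f.hom (Submodule.Quotient.mk (degProj m (T.d c))) = 0
    have h2 : (Submodule.Quotient.mk (T.dDeg m ⟨c, hc⟩) : T.syzygy m) = 0 :=
      (Submodule.Quotient.mk_eq_zero _).mpr ⟨_, rfl⟩
    rw [h1, h2]
    exact map_zero f.hom
  refine ⟨γ, h, ?_⟩
  rw [cocycleClass]
  congr 1
  refine ModuleCat.hom_ext (Submodule.linearMap_qext _ ?_)
  ext c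
  have h1 : degProj m (c : Tot n B) = c := Subtype.ext (degProj_of_mem c.2)
  change f.hom (Submodule.Quotient.mk (degProj m (c : Tot n B))) =
    f.hom (Submodule.Quotient.mk c)
  rw [h1]

theorem eq_zero_of_cocycleClass_eq_zero {γ : Tot n B →ₗ[B] A} (h : T.IsCocycle 0 γ)
    (h0 : T.cocycleClass h = 0) : ∀ c ∈ degPart n B 0, γ c = 0 := by
  intro c hc
  have := T.chain.cls_zero_degree_injective _ h0
  exact LinearMap.congr_fun (congrArg ModuleCat.Hom.hom this) (Submodule.Quotient.mk ⟨c, hc⟩)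

/-- A cocycle with vanishing class is a coboundary. -/
theorem exists_of_cocycleClass_eq_zero {γ : Tot n B →ₗ[B] A} (h : T.IsCocycle (m + 1) γ)
    (h0 : T.cocycleClass h = 0) :
    ∃ β : Tot n B →ₗ[B] A, ∀ c ∈ degPart n B (m + 1), γ c = β (T.d c) := by
  obtain ⟨g, hg⟩ := T.chain.exists_of_cls_eq_zero _ h0
  refine ⟨g.hom ∘ₗ degProj m, fun c hc => ?_⟩
  have h1 : degProj m (T.d c) = T.dDeg m ⟨c, hc⟩ := Subtype.ext (degProj_of_mem (T.d_mem hc))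
  have := LinearMap.congr_fun (congrArg ModuleCat.Hom.hom hg) (Submodule.Quotient.mk ⟨c, hc⟩)
  refine this.trans ?_
  change _ = g.hom (degProj m (T.d c))
  rw [h1]
  rfl

theorem cocycleClass_eq_zero {γ : Tot n B →ₗ[B] A} (h : T.IsCocycle (m + 1) γ)
    (β : Tot n B →ₗ[B] A) (hβ : ∀ c ∈ degPart n B (m + 1), γ c = β (T.d c)) :
    T.cocycleClass h = 0 := by
  rw [← T.chain.cls_comp_eq_zero (ModuleCat.ofHom (β ∘ₗ (degPart n B m).subtype)), cocycleClass]
  congr 1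
  refine ModuleCat.hom_ext (Submodule.linearMap_qext _ ?_)
  ext c
  exact hβ c c.2

section smul

variable {k : Type*} [Field k] [Algebra k B]

theorem IsCocycle.algebra_smul {γ : Tot n B →ₗ[B] A} (h : T.IsCocycle m γ) (r : k) :
    T.IsCocycle m (algebraMap k B r • γ) := fun c hc => by simp [h c hc]

theorem cocycleClass_smul {γ : Tot n B →ₗ[B] A} (h : T.IsCocycle m γ) (r : k) :
    T.cocycleClass (h.algebra_smul r) = r • T.cocycleClass h := by
  rw [cocycleClass, cocycleClass, ← SyzygyChain.cls_smul]
  congr 1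
  refine ModuleCat.hom_ext (Submodule.linearMap_qext _ (LinearMap.ext fun c => ?_))
  rfl

end smul

variable (T) in
/-- A chain map of degree `-a` of the Tate resolution to itself. -/
structure ClosedOp (a : ℕ) where
  /-- the operator on the total complex, in all degrees at once -/
  toFun : Tot n B →ₗ[B] Tot n B
  homog : ∀ m, ∀ c ∈ degPart n B (a + m), toFun c ∈ degPart n B m
  comm : ∀ c, toFun (T.d c) = T.d (toFun c)

namespace ClosedOp

variable {a b : ℕ} (φ : T.ClosedOp a)

theorem isCocycle : T.IsCocycle a (aug A ∘ₗ φ.toFun) := fun c _ => by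
  rw [LinearMap.comp_apply, φ.comm, T.aug_d]

/-- The class of a chain map of degree `-a` in the `a`-th Ext group. -/
def cls : Ext.{u} (ModuleCat.of B A) (ModuleCat.of B A) a := T.cocycleClass φ.isCocycle

theorem isCocycle_comp {γ : Tot n B →ₗ[B] A} (h : T.IsCocycle b γ) :
    T.IsCocycle (a + b) (γ ∘ₗ φ.toFun) := fun c hc => by
  rw [LinearMap.comp_apply, φ.comm]
  exact h _ (φ.homog _ _ hc)

/-- The action of a chain map on the terms of the resolution. -/
def onDeg (j : ℕ) : degPart n B (a + j) →ₗ[B] degPart n B j :=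
  φ.toFun.restrict fun c hc => φ.homog j c hc

/-- The action of a chain map on the syzygies. -/
def onSyzygy (j : ℕ) : T.syzygy (a + j) →ₗ[B] T.syzygy j :=
  Submodule.mapQ _ _ (φ.onDeg j) (by
    rintro _ ⟨c, rfl⟩
    exact ⟨φ.onDeg (j + 1) c, Subtype.ext (φ.comm c).symm⟩)

theorem onSyzygy_comp_mkQ (j : ℕ) :
    φ.onSyzygy j ∘ₗ Submodule.mkQ (LinearMap.range (T.dDeg (a + j))) =
      Submodule.mkQ (LinearMap.range (T.dDeg j)) ∘ₗ φ.onDeg j := LinearMap.ext fun _ => rfl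

/-- Yoneda products with the class of a chain map are given by composition. -/
theorem cls_comp_cocycleClass {γ : Tot n B →ₗ[B] A} (h : T.IsCocycle b γ) :
    φ.cls.comp (T.cocycleClass h) rfl = T.cocycleClass (φ.isCocycle_comp h) := by
  have hi : ∀ j, T.chain.i (a + j) ≫ ModuleCat.ofHom (φ.onDeg j) =
      ModuleCat.ofHom (φ.onSyzygy (j + 1)) ≫ T.chain.i j := by
    intro j
    refine ModuleCat.hom_ext (Submodule.linearMap_qext _ (LinearMap.ext fun c => ?_))
    exact Subtype.ext (φ.comm c)
  have hp : ∀ j, T.chain.p (a + j) ≫ ModuleCat.ofHom (φ.onSyzygy j) =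
      ModuleCat.ofHom (φ.onDeg j) ≫ T.chain.p j := by
    intro j
    exact congrArg ModuleCat.ofHom (φ.onSyzygy_comp_mkQ j)
  have := T.chain.cls_comp_cls (a := a) (b := b) (fun j => ModuleCat.ofHom (φ.onSyzygy j))
    (fun j => ModuleCat.ofHom (φ.onDeg j)) hi hp h.hom
  have e1 : φ.isCocycle.hom = ModuleCat.ofHom (φ.onSyzygy 0) ≫ T.chain.aug.inv := by
    refine ModuleCat.hom_ext (Submodule.linearMap_qext _ (LinearMap.ext fun c => ?_))
    rfl
  have e2 : ModuleCat.ofHom (φ.onSyzygy b) ≫ h.hom = (φ.isCocycle_comp h).hom := by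
    refine ModuleCat.hom_ext (Submodule.linearMap_qext _ (LinearMap.ext fun c => ?_))
    rfl
  have e3 : φ.cls = T.chain.cls (ModuleCat.ofHom (φ.onSyzygy 0) ≫ T.chain.aug.inv) :=
    congrArg T.chain.cls e1
  rw [e3]
  exact this.trans (congrArg T.chain.cls e2)

end ClosedOp

end TateData

end Koszul

/-! ### The resolution of a square-free hypersurface over its enveloping algebra -/

namespace Koszul

variable {n : ℕ}

/-- Tate data whose elements `g_i` are the partial products which appear when the monomial
`x_1 ⋯ x_n` is written in terms of the differences of the two copies of the variables. The
elements `y_i` lift the variables `x_i` of the quotient. The last condition writes `y_i g_i` as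
a combination of the `z_j`; it is what makes `x_i ι_i` extend to a chain map. -/
structure HypersurfaceData {B A : Type u} [CommRing B] [CommRing A] [Algebra B A]
    (x : Fin n → A) extends TateData n B A where
  /-- lifts of the variables -/
  y : Fin n → B
  algebraMap_y : ∀ i, algebraMap B A (y i) = x i
  algebraMap_g : ∀ i, algebraMap B A (g i) = ∏ j ∈ Finset.univ.erase i, x j
  y_mul_g : ∀ i, y i * g i = ∑ j, z j * if j < i then g j else 0

section polynomial

open MvPolynomial

variable {A : Type u} [CommRing A] (x : Fin n → A)

/-- The product `(∏_{j < i} (X_j + x_j)) (∏_{j > i} x_j)`. -/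
def partialProd (i : Fin n) : MvPolynomial (Fin n) A :=
  (∏ j with j < i, (X j + C (x j))) * ∏ j with i < j, C (x j)

theorem prod_eq_lt_mul_gt {M : Type*} [CommMonoid M] (F : Fin n → M) (i : Fin n) :
    ∏ j, F j = (∏ j with j < i, F j) * (F i * ∏ j with i < j, F j) := by
  rw [← Finset.prod_filter_mul_prod_filter_not Finset.univ (· < i) F]
  congr 1
  have : Finset.univ.filter (fun j => ¬ j < i) =
      insert i (Finset.univ.filter fun j => i < j) := by
    ext j; simp [le_iff_eq_or_lt, eq_comm]
  rw [this, Finset.prod_insert (by simp)]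

theorem prod_erase_eq_lt_mul_gt {M : Type*} [CommMonoid M] (F : Fin n → M) (i : Fin n) :
    ∏ j ∈ Finset.univ.erase i, F j = (∏ j with j < i, F j) * ∏ j with i < j, F j := by
  rw [← Finset.prod_union]
  · congr 1
    ext j; simp [lt_or_lt_iff_ne]
  · rw [Finset.disjoint_filter]
    intro j _ h
    exact h.not_gt

/-- A telescoping sum. -/
theorem sum_X_mul_partialProd (hx : ∏ i, x i = 0) :
    ∑ i, X i * partialProd x i = ∏ i, (X i + C (x i)) := by
  have := Finset.prod_add_ordered Finset.univ (fun i => C (σ := Fin n) (x i)) X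
  rw [← map_prod, hx, map_zero, zero_add] at this
  simp only [partialProd, ← mul_assoc]
  simpa only [add_comm] using this.symm

/-- The telescoping sum for the product of `X_j + x_j` over `j < i` and of `x_j` over `j ≥ i`. -/
theorem C_mul_partialProd (hx : ∏ i, x i = 0) (i : Fin n) :
    C (x i) * partialProd x i = ∑ j, X j * if j < i then partialProd x j else 0 := by
  have := Finset.prod_add_ordered Finset.univ (fun i => C (σ := Fin n) (x i))
    (fun j => if j < i then X j else 0)
  rw [← map_prod, hx, map_zero, zero_add, prod_eq_lt_mul_gt _ i] at this
  have h1 : ∏ j with j < i, (C (x j) + if j < i then (X j : MvPolynomial (Fin n) A) else 0) =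
      ∏ j with j < i, (X j + C (x j)) := by
    refine Finset.prod_congr rfl fun j hj => ?_
    rw [if_pos (Finset.mem_filter.mp hj).2, add_comm]
  have h2 : ∏ j with i < j, (C (x j) + if j < i then (X j : MvPolynomial (Fin n) A) else 0) =
      ∏ j with i < j, C (x j) := by
    refine Finset.prod_congr rfl fun j hj => ?_
    rw [if_neg (Finset.mem_filter.mp hj).2.not_gt, add_zero]
  rw [h1, h2, if_neg (lt_irrefl i), add_zero] at this
  rw [partialProd, mul_left_comm, this]
  refine Finset.sum_congr rfl fun j _ => ?_
  by_cases hj : j < i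
  · rw [if_pos hj, if_pos hj, partialProd, mul_assoc]
    congr 2
    refine Finset.prod_congr rfl fun l hl => ?_
    rw [if_pos ((Finset.mem_filter.mp hl).2.trans hj), add_comm]
  · rw [if_neg hj, if_neg hj, zero_mul, zero_mul, mul_zero]

theorem constantCoeff_partialProd (i : Fin n) :
    constantCoeff (partialProd x i) = ∏ j ∈ Finset.univ.erase i, x j := by
  rw [prod_erase_eq_lt_mul_gt, partialProd, map_mul, map_prod, map_prod]
  simp

/-- The product of the `X_i + x_i` is a nonzerodivisor, since it becomes the monomial
`X_1 ⋯ X_n` after a translation of the variables. -/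
theorem eq_zero_of_prod_X_add_C_mul_eq_zero (r : MvPolynomial (Fin n) A)
    (h : (∏ i, (X i + C (x i))) * r = 0) : r = 0 := by
  let θ : MvPolynomial (Fin n) A →ₐ[A] MvPolynomial (Fin n) A := aeval fun i => X i - C (x i)
  let θ' : MvPolynomial (Fin n) A →ₐ[A] MvPolynomial (Fin n) A := aeval fun i => X i + C (x i)
  have hθ : ∀ r, θ' (θ r) = r := by
    intro r
    have : θ'.comp θ = AlgHom.id A _ := by
      ext i : 1
      simp [θ, θ']
    exact AlgHom.congr_fun this r
  have h1 : (∏ i, X i) * θ r = 0 := by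
    have := congrArg θ h
    rw [map_mul, map_prod, map_zero] at this
    simpa [θ] using this
  have h2 : ∀ (s : Finset (Fin n)) (p : MvPolynomial (Fin n) A), (∏ i ∈ s, X i) * p = 0 →
      p = 0 := by
    intro s
    induction s using Finset.induction_on with
    | empty => intro p hp; simpa using hp
    | insert i s hi ih =>
      intro p hp
      rw [Finset.prod_insert hi, mul_assoc] at hp
      refine ih p ?_
      have := X_mul_divMonomial i ((∏ i ∈ s, X i) * p)
      rw [hp, zero_divMonomial] at this
      exact this.symm
  rw [← hθ r, h2 _ _ h1, map_zero]

end polynomial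

/-- The elements `x_i` present `A` as the algebra `k[x₁, …, xₙ] / (x₁ ⋯ xₙ)`. -/
structure IsSquareFreeHypersurface (k : Type u) [Field k] {A : Type u} [CommRing A] [Algebra k A]
    (x : Fin n → A) : Prop where
  surjective : Function.Surjective (MvPolynomial.aeval (R := k) x)
  aeval_eq_zero_iff : ∀ p : MvPolynomial (Fin n) k,
    MvPolynomial.aeval x p = 0 ↔ ∏ i, MvPolynomial.X i ∣ p

theorem IsSquareFreeHypersurface.prod_eq_zero {k : Type u} [Field k] {A : Type u} [CommRing A]
    [Algebra k A] {x : Fin n → A} (H : IsSquareFreeHypersurface k x) : ∏ i, x i = 0 := by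
  have := (H.aeval_eq_zero_iff _).mpr dvd_rfl
  rw [map_prod] at this
  simpa using this

section envelope

open MvPolynomial

variable (k : Type u) [Field k] {A : Type u} [CommRing A] [Algebra k A]

section

attribute [local instance] TensorProduct.Algebra.module

theorem envelope_smul_mul (r : A ⊗[k] Aᵐᵒᵖ) (a b : A) : r • a * b = r • (a * b) := by
  induction r using TensorProduct.induction_on with
  | zero =>
    have h : ∀ a : A, (0 : A ⊗[k] Aᵐᵒᵖ) • a = 0 := Module.zero_smul
    exact (congrArg (fun t => t * b) (h a)).trans ((zero_mul b).trans (h (a * b)).symm)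
  | tmul s t =>
    rw [TensorProduct.Algebra.smul_def, TensorProduct.Algebra.smul_def]
    simp only [smul_eq_mul, MulOpposite.smul_eq_mul_unop]; ring
  | add r s hr hs => rw [add_smul, add_smul, add_mul, hr, hs]

variable (A) in
/-- A commutative algebra as an algebra over its enveloping algebra, by multiplication. The
underlying module is the regular bimodule. -/
@[reducible] def envelopeAlgebra : Algebra (A ⊗[k] Aᵐᵒᵖ) A :=
  Algebra.ofModule (envelope_smul_mul k)
    (fun r a b => by rw [mul_comm, envelope_smul_mul, mul_comm])

theorem envelopeAlgebra_algebraMap_tmul (a : A) (b : Aᵐᵒᵖ) :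
    (envelopeAlgebra k A).algebraMap (a ⊗ₜ b) = a * b.unop := by
  change (a ⊗ₜ[k] b) • (1 : A) = _
  rw [TensorProduct.Algebra.smul_def]
  simp [MulOpposite.smul_eq_mul_unop]

end

attribute [local instance] envelopeAlgebra

theorem algebraMap_tmul (a : A) (b : Aᵐᵒᵖ) :
    algebraMap (A ⊗[k] Aᵐᵒᵖ) A (a ⊗ₜ b) = a * b.unop :=
  envelopeAlgebra_algebraMap_tmul k a b

variable (A) in
theorem isScalarTower_envelope : IsScalarTower k (A ⊗[k] Aᵐᵒᵖ) A :=
  IsScalarTower.of_algebraMap_eq (R := k) (S := A ⊗[k] Aᵐᵒᵖ) (A := A) fun r => by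
    rw [Algebra.TensorProduct.algebraMap_apply, algebraMap_tmul]; simp

variable (x : Fin n → A)

/-- The presentation of the enveloping algebra as a quotient of a polynomial ring over the right
tensor factor, the variables being sent to the differences `x_i ⊗ 1 - 1 ⊗ x_i`. -/
def toEnvelope : MvPolynomial (Fin n) A →+* A ⊗[k] Aᵐᵒᵖ :=
  eval₂Hom ((Algebra.TensorProduct.includeRight (R := k) (A := A) (B := Aᵐᵒᵖ)).comp
    (AlgEquiv.toOpposite k A).toAlgHom).toRingHom
    fun i => x i ⊗ₜ 1 - 1 ⊗ₜ MulOpposite.op (x i)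

theorem toEnvelope_C (a : A) : toEnvelope k x (C a) = 1 ⊗ₜ MulOpposite.op a := by
  simp [toEnvelope]

theorem toEnvelope_X (i : Fin n) : toEnvelope k x (X i) =
    x i ⊗ₜ 1 - 1 ⊗ₜ MulOpposite.op (x i) := by
  simp [toEnvelope]

theorem algebraMap_toEnvelope (r : MvPolynomial (Fin n) A) :
    algebraMap (A ⊗[k] Aᵐᵒᵖ) A (toEnvelope k x r) = constantCoeff r := by
  have : (algebraMap (A ⊗[k] Aᵐᵒᵖ) A).comp (toEnvelope k x) = constantCoeff := by
    refine MvPolynomial.ringHom_ext (fun a => ?_) fun i => ?_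
    · rw [RingHom.comp_apply, toEnvelope_C, algebraMap_tmul]; simp
    · rw [RingHom.comp_apply, toEnvelope_X, map_sub, algebraMap_tmul, algebraMap_tmul]; simp
  exact RingHom.congr_fun this r

theorem toEnvelope_X_add_C (i : Fin n) :
    toEnvelope k x (X i + C (x i)) =
      (Algebra.TensorProduct.includeLeft : A →ₐ[k] A ⊗[k] Aᵐᵒᵖ) (x i) := by
  rw [map_add, toEnvelope_X, toEnvelope_C, sub_add_cancel]
  rfl

/-- The left tensor factor is reached by the elements `X_i + x_i`. -/
theorem toEnvelope_aeval (p : MvPolynomial (Fin n) k) :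
    toEnvelope k x (aeval (fun i => X i + C (x i)) p) =
      (Algebra.TensorProduct.includeLeft : A →ₐ[k] A ⊗[k] Aᵐᵒᵖ) (aeval x p) := by
  induction p using MvPolynomial.induction_on with
  | C r =>
    rw [algHom_C, algHom_C, IsScalarTower.algebraMap_apply k A (MvPolynomial (Fin n) A),
      MvPolynomial.algebraMap_eq, toEnvelope_C, AlgHom.commutes,
      Algebra.TensorProduct.algebraMap_apply']
    rfl
  | add p q hp hq => rw [map_add, map_add, hp, hq, map_add, map_add]
  | mul_X p i hp =>
    rw [map_mul, map_mul, hp, aeval_X, toEnvelope_X_add_C, map_mul, map_mul, aeval_X]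

variable {k x}

theorem toEnvelope_surjective (H : IsSquareFreeHypersurface k x) :
    Function.Surjective (toEnvelope k x) := by
  intro b
  induction b using TensorProduct.induction_on with
  | zero => exact ⟨0, map_zero _⟩
  | tmul a b =>
    obtain ⟨p, rfl⟩ := H.surjective a
    refine ⟨aeval (fun i => X i + C (x i)) p * C b.unop, ?_⟩
    rw [map_mul, toEnvelope_aeval, toEnvelope_C, Algebra.TensorProduct.includeLeft_apply,
      Algebra.TensorProduct.tmul_mul_tmul]
    simp
  | add a b ha hb =>
    obtain ⟨r, rfl⟩ := ha
    obtain ⟨s, rfl⟩ := hb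
    exact ⟨r + s, map_add _ _ _⟩

theorem toEnvelope_prod (H : IsSquareFreeHypersurface k x) :
    toEnvelope k x (∏ i, (X i + C (x i))) = 0 := by
  simp only [map_prod (toEnvelope k x), toEnvelope_X_add_C]
  rw [← map_prod, H.prod_eq_zero, map_zero]

/-- The kernel of the presentation of the enveloping algebra is generated by `∏ (X_i + x_i)`. -/
theorem dvd_of_toEnvelope_eq_zero (H : IsSquareFreeHypersurface k x)
    (r : MvPolynomial (Fin n) A) (hr : toEnvelope k x r = 0) : ∏ i, (X i + C (x i)) ∣ r := by
  -- The quotient by the product receives a map `ρ` from the enveloping algebra, and the composite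
  -- of `ρ` with the presentation is the projection onto the quotient.
  set f : MvPolynomial (Fin n) A := ∏ i, (X i + C (x i)) with hf
  let Q := MvPolynomial (Fin n) A ⧸ Ideal.span {f}
  let α' : MvPolynomial (Fin n) k →ₐ[k] Q :=
    aeval (R := k) fun i => (Ideal.Quotient.mk (Ideal.span {f}) (X i + C (x i)) : Q)
  let α : A →ₐ[k] Q := AlgHom.liftOfSurjective (aeval x) H.surjective α' (by
      intro p hp
      obtain ⟨q, rfl⟩ := (H.aeval_eq_zero_iff p).mp hp
      change α' _ = 0
      rw [map_mul, map_prod]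
      simp only [α', aeval_X]
      rw [← map_prod, ← hf, Ideal.Quotient.eq_zero_iff_mem.mpr (Ideal.mem_span_singleton_self f),
        zero_mul])
  let β : Aᵐᵒᵖ →ₐ[k] Q := (IsScalarTower.toAlgHom k A Q).comp
    (AlgEquiv.toOpposite k A).symm.toAlgHom
  let ρ : A ⊗[k] Aᵐᵒᵖ →ₐ[k] Q := Algebra.TensorProduct.lift α β fun _ _ => Commute.all _ _
  have hα : ∀ i, α (x i) = Ideal.Quotient.mk (Ideal.span {f}) (X i + C (x i)) := by
    intro i
    have h1 : α (aeval x (X (R := k) i)) = α' (X i) := AlgHom.liftOfSurjective_apply _ _ _ _ _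
    rw [aeval_X] at h1
    rw [h1]
    exact aeval_X _ i
  have hβ : ∀ a, β (MulOpposite.op a) = Ideal.Quotient.mk (Ideal.span {f}) (C a) := fun a => rfl
  have h : (ρ : A ⊗[k] Aᵐᵒᵖ →+* Q).comp (toEnvelope k x) = Ideal.Quotient.mk (Ideal.span {f}) := by
    refine MvPolynomial.ringHom_ext (fun a => ?_) fun i => ?_
    · rw [RingHom.comp_apply, toEnvelope_C]
      change ρ _ = _
      rw [Algebra.TensorProduct.lift_tmul, map_one, one_mul, hβ]
    · rw [RingHom.comp_apply, toEnvelope_X]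
      change ρ _ = _
      rw [map_sub, Algebra.TensorProduct.lift_tmul, Algebra.TensorProduct.lift_tmul, map_one,
        mul_one, map_one, one_mul, hα, hβ, map_add, add_sub_cancel_right]
  have h1 := RingHom.congr_fun h r
  rw [RingHom.comp_apply, hr, map_zero] at h1
  exact Ideal.mem_span_singleton.mp (Ideal.Quotient.eq_zero_iff_mem.mp h1.symm)

theorem exists_totD_envelope_eq (H : IsSquareFreeHypersurface k x) (c : Tot n (A ⊗[k] Aᵐᵒᵖ))
    (hc : totD (toEnvelope k x ∘ X) (toEnvelope k x ∘ partialProd x) c = 0)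
    (h0 : algebraMap (A ⊗[k] Aᵐᵒᵖ) A (c 0 ∅) = 0) :
    ∃ b, totD (toEnvelope k x ∘ X) (toEnvelope k x ∘ partialProd x) b = c := by
  obtain ⟨b, hb⟩ := exists_total_differential_eq (toEnvelope k x) (toEnvelope_surjective H)
    X (partialProd x)
    (fun r hr => by
      rw [sum_X_mul_partialProd _ H.prod_eq_zero]
      exact dvd_of_toEnvelope_eq_zero H r hr)
    (fun r hr => by
      rw [sum_X_mul_partialProd _ H.prod_eq_zero] at hr
      exact eq_zero_of_prod_X_add_C_mul_eq_zero _ r hr)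
    (algebraMap (A ⊗[k] Aᵐᵒᵖ) A)
    (fun c hc h => exists_koszulD_eq c hc (by rwa [algebraMap_toEnvelope] at h))
    c (fun l => congrFun hc l) h0
  exact ⟨b, funext hb⟩

/-- The Tate data for the ring `k[x₁, …, xₙ] / (x₁ ⋯ xₙ)` over its enveloping algebra. -/
def envelopeData (H : IsSquareFreeHypersurface k x) :
    HypersurfaceData (B := A ⊗[k] Aᵐᵒᵖ) x where
  z := toEnvelope k x ∘ X
  g := toEnvelope k x ∘ partialProd x
  y i := toEnvelope k x (C (x i))
  sum_mul_eq_zero := by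
    simp only [Function.comp_apply, ← map_mul, ← map_sum]
    rw [sum_X_mul_partialProd _ H.prod_eq_zero, toEnvelope_prod H]
  algebraMap_z i := by rw [Function.comp_apply, algebraMap_toEnvelope, constantCoeff_X]
  algebraMap_y i := by rw [algebraMap_toEnvelope, constantCoeff_C]
  algebraMap_g i := by
    rw [Function.comp_apply, algebraMap_toEnvelope, constantCoeff_partialProd]
  y_mul_g i := by
    rw [Function.comp_apply, ← map_mul, C_mul_partialProd _ H.prod_eq_zero, map_sum]
    refine Finset.sum_congr rfl fun j _ => ?_
    rw [map_mul, Function.comp_apply, Function.comp_apply]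
    congr 1
    split_ifs
    · rfl
    · exact map_zero _
  surjective a := ⟨toEnvelope k x (C a), by rw [algebraMap_toEnvelope, constantCoeff_C]⟩
  exact := exists_totD_envelope_eq H

end envelope

end Koszul

/-! ### Coordinates of the exterior algebra, and classes of linear forms -/

namespace Koszul

variable {n : ℕ}

section coord

variable {B : Type*} [CommRing B]

/-- The grading involution `c_I ↦ (-1)^|I| c_I` of the exterior algebra. -/
def twist : (Finset (Fin n) → B) →ₗ[B] (Finset (Fin n) → B) where
  toFun c I := (-1 : ℤ) ^ I.card • c I
  map_add' c d := by ext I; simp [-zsmul_eq_mul]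
  map_smul' r c := by ext I; simp [-zsmul_eq_mul]

theorem twist_apply (c : Finset (Fin n) → B) (I : Finset (Fin n)) :
    twist c I = (-1 : ℤ) ^ I.card • c I := rfl

theorem twist_contr (i : Fin n) (c : Finset (Fin n) → B) :
    twist (contr i c) = -contr i (twist c) := by
  ext I
  rw [twist_apply, Pi.neg_apply, contr_apply, contr_apply]
  split_ifs with h
  · simp
  · rw [twist_apply, Finset.card_insert_of_notMem h, smul_comm, pow_succ, mul_neg_one, neg_smul,
      smul_neg, neg_neg]

theorem twist_wedge (i : Fin n) (c : Finset (Fin n) → B) :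
    twist (wedge i c) = -wedge i (twist c) := by
  ext I
  rw [twist_apply, Pi.neg_apply, wedge_apply, wedge_apply]
  split_ifs with h
  · rw [twist_apply, ← Finset.card_erase_add_one h, smul_comm, pow_succ, mul_neg_one, neg_smul,
      smul_neg]
  · simp

theorem twist_koszulD (z : Fin n → B) (c : Finset (Fin n) → B) :
    twist (koszulD z c) = -koszulD z (twist c) := by
  simp only [koszulD_apply, map_sum, map_smul, twist_contr, smul_neg, Finset.sum_neg_distrib]

theorem twist_wedgeW (g : Fin n → B) (c : Finset (Fin n) → B) :
    twist (wedgeW g c) = -wedgeW g (twist c) := by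
  simp only [wedgeW_apply, map_sum, map_smul, twist_wedge, smul_neg, Finset.sum_neg_distrib]

/-- The linear form on the exterior algebra which contracts successively against the dual basis
vectors `i_1, …, i_p` of a list and takes the scalar component; on a strictly increasing list it is
a coordinate. -/
def coord : List (Fin n) → (Finset (Fin n) → B) →ₗ[B] B
  | [] => LinearMap.proj ∅
  | i :: l => coord l ∘ₗ contr i

theorem coord_nil (c : Finset (Fin n) → B) : coord [] c = c ∅ := rfl

theorem coord_cons (i : Fin n) (l : List (Fin n)) (c : Finset (Fin n) → B) :
    coord (i :: l) c = coord l (contr i c) := rfl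

theorem coord_of_pairwise {l : List (Fin n)} (hl : l.Pairwise (· < ·))
    (c : Finset (Fin n) → B) : coord l c = c l.toFinset := by
  induction l generalizing c with
  | nil => rfl
  | cons i l ih =>
    rw [List.pairwise_cons] at hl
    rw [coord_cons, ih hl.2, contr_apply, if_neg, List.toFinset_cons]
    · have : sgn i l.toFinset = 1 := by
        rw [sgn, Finset.filter_false_of_mem, Finset.card_empty, pow_zero]
        intro j hj
        exact (hl.1 j (List.mem_toFinset.mp hj)).not_gt
      rw [this, one_smul]
    · rw [List.mem_toFinset]
      exact fun h => lt_irrefl i (hl.1 i h)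

theorem coord_twist (l : List (Fin n)) (c : Finset (Fin n) → B) :
    coord l (twist c) = (-1 : ℤ) ^ l.length • coord l c := by
  induction l generalizing c with
  | nil => simp [coord_nil, twist_apply]
  | cons i l ih =>
    rw [coord_cons, coord_cons, ← neg_neg (contr i (twist c)), ← twist_contr, map_neg, ih,
      List.length_cons, pow_succ, mul_neg_one, neg_smul]

theorem coord_koszulD (z : Fin n → B) (l : List (Fin n)) (c : Finset (Fin n) → B) :
    coord l (koszulD z c) ∈ Ideal.span (Set.range z) := by
  induction l generalizing c with
  | nil =>
    rw [coord_nil, koszulD_apply_empty]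
    exact Ideal.sum_mem _ fun i _ => Ideal.mul_mem_right _ _ (Ideal.subset_span ⟨i, rfl⟩)
  | cons i l ih =>
    rw [coord_cons, contr_koszulD, map_neg]
    exact neg_mem (ih _)

/-- The coboundary of a coordinate is the alternating sum which appears in the presentation of the
Hochschild cohomology ring. -/
theorem coord_wedgeW (g : Fin n → B) (l : List (Fin n)) (c : Finset (Fin n) → B) :
    coord l (wedgeW g c) =
      ∑ t : Fin l.length, (-1 : ℤ) ^ (t : ℕ) • (g (l.get t) * coord (l.eraseIdx t) c) := by
  induction l generalizing c with
  | nil => simp [coord_nil, wedgeW_apply_empty]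
  | cons i l ih =>
    rw [coord_cons, contr_wedgeW, map_sub, map_smul, ih]
    change _ = ∑ t : Fin (l.length + 1), _
    rw [Fin.sum_univ_succ, sub_eq_add_neg, ← Finset.sum_neg_distrib]
    congr 1
    · simp
    · refine Finset.sum_congr rfl fun t _ => ?_
      simp [pow_succ, coord_cons]

end coord

variable {B A : Type u} [CommRing B] [CommRing A] [Algebra B A]

namespace TateData

variable (T : TateData n B A)

/-- Multiplication by a scalar, as a chain map of degree zero; it represents the classes `X_i`. -/
def mulOp (b : B) : T.ClosedOp 0 where
  toFun := LinearMap.lsmul B (Tot n B) b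
  homog m c hc := Submodule.smul_mem _ _ (by rwa [zero_add] at hc)
  comm c := (map_smul T.d b c).symm

theorem mulOp_apply (b : B) (c : Tot n B) : (T.mulOp b).toFun c = b • c := rfl

/-- The shift of the divided powers, as a chain map of degree `-2`; it represents the class `Z`. -/
def shiftOp : T.ClosedOp 2 where
  toFun := LinearMap.funLeft B (Finset (Fin n) → B) Nat.succ
  homog m c hc l I h := hc _ _ (by simp only [Nat.succ_eq_add_one]; lia)
  comm c := rfl

open scoped Classical in
/-- The class in degree `m` of a linear form on the total complex; zero if the form is not a
cocycle in this degree. -/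
def classOf (m : ℕ) (γ : Tot n B →ₗ[B] A) :
    Ext.{u} (ModuleCat.of B A) (ModuleCat.of B A) m :=
  if h : T.IsCocycle m γ then T.cocycleClass h else 0

variable {T} {m : ℕ}

theorem classOf_eq {γ : Tot n B →ₗ[B] A} (h : T.IsCocycle m γ) :
    T.classOf m γ = T.cocycleClass h := dif_pos h

theorem classOf_congr {γ γ' : Tot n B →ₗ[B] A} (h : T.IsCocycle m γ) (h' : T.IsCocycle m γ')
    (hγ : ∀ c ∈ degPart n B m, γ c = γ' c) : T.classOf m γ = T.classOf m γ' := by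
  rw [classOf_eq h, classOf_eq h', cocycleClass_congr h h' hγ]

theorem classOf_zero : T.classOf m (0 : Tot n B →ₗ[B] A) = 0 := by
  rw [classOf_eq isCocycle_zero, cocycleClass_zero]

theorem classOf_add {γ γ' : Tot n B →ₗ[B] A} (h : T.IsCocycle m γ) (h' : T.IsCocycle m γ') :
    T.classOf m (γ + γ') = T.classOf m γ + T.classOf m γ' := by
  rw [classOf_eq h, classOf_eq h', classOf_eq (h.add h'), cocycleClass_add]

theorem IsCocycle.sum {ι : Type*} (s : Finset ι) (γ : ι → Tot n B →ₗ[B] A)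
    (h : ∀ i ∈ s, T.IsCocycle m (γ i)) : T.IsCocycle m (∑ i ∈ s, γ i) := by
  intro c hc
  rw [LinearMap.sum_apply]
  exact Finset.sum_eq_zero fun i hi => h i hi c hc

theorem classOf_sum {ι : Type*} (s : Finset ι) (γ : ι → Tot n B →ₗ[B] A)
    (h : ∀ i ∈ s, T.IsCocycle m (γ i)) :
    T.classOf m (∑ i ∈ s, γ i) = ∑ i ∈ s, T.classOf m (γ i) := by
  classical
  induction s using Finset.induction_on with
  | empty => exact classOf_zero
  | insert i s hi ih =>
    rw [Finset.sum_insert hi, Finset.sum_insert hi,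
      classOf_add (h i (Finset.mem_insert_self _ _))
        (IsCocycle.sum s γ fun j hj => h j (Finset.mem_insert_of_mem hj)),
      ih fun j hj => h j (Finset.mem_insert_of_mem hj)]

theorem classOf_smul {k : Type*} [Field k] [Algebra k B] {γ : Tot n B →ₗ[B] A}
    (h : T.IsCocycle m γ) (r : k) : T.classOf m (algebraMap k B r • γ) = r • T.classOf m γ := by
  rw [classOf_eq h, classOf_eq (h.algebra_smul r), cocycleClass_smul]

theorem IsCocycle.smul {γ : Tot n B →ₗ[B] A} (h : T.IsCocycle m γ) (a : A) :
    T.IsCocycle m (a • γ) := fun c hc => by rw [LinearMap.smul_apply, h c hc, smul_zero]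

variable (T) in
/-- The element of the Yoneda algebra which is given by a linear form in degree `m`. -/
def hh (m : ℕ) (γ : Tot n B →ₗ[B] A) :
    ⨁ m, Ext.{u} (ModuleCat.of B A) (ModuleCat.of B A) m :=
  DirectSum.of (fun m => Ext.{u} (ModuleCat.of B A) (ModuleCat.of B A) m) m (T.classOf m γ)

theorem hh_congr {γ γ' : Tot n B →ₗ[B] A} {m' : ℕ} (hm : m = m') (h : T.IsCocycle m γ)
    (h' : T.IsCocycle m' γ') (hγ : ∀ c ∈ degPart n B m, γ c = γ' c) : T.hh m γ = T.hh m' γ' := by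
  subst hm
  rw [hh, classOf_congr h h' hγ, hh]

theorem hh_zero : T.hh m 0 = 0 := by rw [hh, classOf_zero, map_zero]

theorem hh_add {γ γ' : Tot n B →ₗ[B] A} (h : T.IsCocycle m γ) (h' : T.IsCocycle m γ') :
    T.hh m (γ + γ') = T.hh m γ + T.hh m γ' := by rw [hh, classOf_add h h', map_add, hh, hh]

theorem hh_sum {ι : Type*} (s : Finset ι) (γ : ι → Tot n B →ₗ[B] A)
    (h : ∀ i ∈ s, T.IsCocycle m (γ i)) : T.hh m (∑ i ∈ s, γ i) = ∑ i ∈ s, T.hh m (γ i) := by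
  rw [hh, classOf_sum s γ h, map_sum]; rfl

theorem hh_smul {k : Type u} [Field k] [Algebra k B] {γ : Tot n B →ₗ[B] A}
    (h : T.IsCocycle m γ) (r : k) : T.hh m (algebraMap k B r • γ) = r • T.hh m γ := by
  rw [hh, hh, classOf_smul h]
  exact DirectSum.of_smul k m r (T.classOf m γ)

variable (T) in
/-- The element of the Yoneda algebra which is given by a chain map. -/
def hhOp {a : ℕ} (φ : T.ClosedOp a) :
    ⨁ m, Ext.{u} (ModuleCat.of B A) (ModuleCat.of B A) m := T.hh a (aug A ∘ₗ φ.toFun)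

theorem hhOp_mul_hh {a b : ℕ} (φ : T.ClosedOp a) {γ : Tot n B →ₗ[B] A} (h : T.IsCocycle b γ) :
    T.hhOp φ * T.hh b γ = T.hh (a + b) (γ ∘ₗ φ.toFun) := by
  rw [hhOp, hh, hh, DirectSum.of_mul_of, hh, classOf_eq φ.isCocycle, classOf_eq h,
    classOf_eq (φ.isCocycle_comp h)]
  congr 1
  exact φ.cls_comp_cocycleClass h

theorem hh_aug : T.hh 0 (aug A) = 1 := by
  have h1 : T.hhOp (T.mulOp 1) = T.hh 0 (aug A) := by
    rw [hhOp]
    congr 1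
    ext c
    simp [mulOp_apply]
  -- As multiplication by `1` is the identity, the class is a left unit, hence the unit.
  have h2 : ∀ y : ⨁ m, Ext.{u} (ModuleCat.of B A) (ModuleCat.of B A) m, T.hh 0 (aug A) * y = y := by
    intro y
    induction y using DirectSum.induction_on with
    | zero => exact mul_zero _
    | add y z hy hz => rw [mul_add, hy, hz]
    | of m α =>
      obtain ⟨γ, h, rfl⟩ := T.exists_cocycleClass_eq α
      rw [← classOf_eq h]
      change T.hh 0 (aug A) * T.hh m γ = T.hh m γ
      rw [← h1, hhOp_mul_hh _ h]
      refine hh_congr (zero_add m) ((T.mulOp 1).isCocycle_comp h) h fun c _ => ?_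
      rw [LinearMap.comp_apply, mulOp_apply, one_smul]
  rw [← mul_one (T.hh 0 (aug A)), h2]

theorem hhOp_mul_hhOp {a b : ℕ} (φ : T.ClosedOp a) (ψ : T.ClosedOp b) :
    T.hhOp φ * T.hhOp ψ = T.hh (a + b) ((aug A ∘ₗ ψ.toFun) ∘ₗ φ.toFun) :=
  hhOp_mul_hh φ ψ.isCocycle

/-- The classes of two chain maps commute if the chain maps do so up to the augmentation. -/
theorem hhOp_mul_hhOp_comm {a b : ℕ} (φ : T.ClosedOp a) (ψ : T.ClosedOp b)
    (h : ∀ c, aug A (ψ.toFun (φ.toFun c)) = aug A (φ.toFun (ψ.toFun c))) :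
    T.hhOp φ * T.hhOp ψ = T.hhOp ψ * T.hhOp φ :=
  (hhOp_mul_hhOp φ ψ).trans ((hh_congr (add_comm a b) (φ.isCocycle_comp ψ.isCocycle)
    (ψ.isCocycle_comp φ.isCocycle) fun c _ => h c).trans (hhOp_mul_hhOp ψ φ).symm)

end TateData

end Koszul

/-! ### The classes of the variables and their relations -/

namespace Koszul

variable {n : ℕ}

variable {B A : Type u} [CommRing B] [CommRing A] [Algebra B A]

/-- The linear form on the total complex which sends `c` to `a` times the image in `A` of the
coordinate of `c j` which belongs to the list `l`. -/
def cochain (a : A) (l : List (Fin n)) (j : ℕ) : Tot n B →ₗ[B] A :=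
  a • (Algebra.linearMap B A ∘ₗ coord l ∘ₗ LinearMap.proj j)

theorem cochain_apply (a : A) (l : List (Fin n)) (j : ℕ) (c : Tot n B) :
    cochain a l j c = a * algebraMap B A (coord l (c j)) := rfl

theorem cochain_zero (l : List (Fin n)) (j : ℕ) : cochain (B := B) (0 : A) l j = 0 := by
  ext c; rw [cochain_apply, zero_mul, LinearMap.zero_apply]

theorem smul_cochain (b a : A) (l : List (Fin n)) (j : ℕ) :
    b • cochain (B := B) a l j = cochain (b * a) l j := by
  rw [cochain, cochain, mul_smul]

theorem cochain_nil_zero : cochain (B := B) (n := n) (1 : A) [] 0 = aug A := by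
  ext c; simp [cochain_apply, coord_nil, aug_apply]

/-- The sign of the product of `p` classes of degree one: it comes from the grading involution in
the chain maps which represent these classes. -/
def prodSign : ℕ → ℤ
  | 0 => 1
  | p + 1 => (-1) ^ (p + 1) * prodSign p

theorem prodSign_mul_self (p : ℕ) : prodSign p * prodSign p = 1 := by
  induction p with
  | zero => rfl
  | succ p ih =>
    rw [prodSign, mul_mul_mul_comm, ih, ← mul_pow]; simp

namespace TateData

variable (T : TateData n B A)

/-- The coboundary of `cochain a l j`: the Koszul part of the differential has coefficients in the
ideal of the elements `z_i`, which vanish in `A`. -/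
theorem cochain_d (a : A) (l : List (Fin n)) (j : ℕ) (c : Tot n B) :
    cochain a l j (T.d c) = ∑ t : Fin l.length,
      (-1 : ℤ) ^ (t : ℕ) •
        cochain (a * algebraMap B A (T.g (l.get t))) (l.eraseIdx t) (j + 1) c := by
  have h : ∀ b ∈ Ideal.span (Set.range T.z), algebraMap B A b = 0 := by
    intro b hb
    have : Ideal.span (Set.range T.z) ≤ RingHom.ker (algebraMap B A) := by
      rw [Ideal.span_le]
      rintro _ ⟨i, rfl⟩
      exact T.algebraMap_z i
    exact this hb
  rw [cochain_apply, d_apply, map_add, map_add, h _ (coord_koszulD _ _ _), zero_add, coord_wedgeW,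
    map_sum, Finset.mul_sum]
  refine Finset.sum_congr rfl fun t _ => ?_
  rw [map_zsmul, map_mul, mul_smul_comm, cochain_apply, mul_assoc]

variable {T}

/-- If `a` is annihilated by the images of `g_i` for `i` in the list `l`, then the linear form
`cochain a l j` is a cocycle in every degree. -/
theorem cochain_isCocycle {a : A} {l : List (Fin n)}
    (h : ∀ i ∈ l, a * algebraMap B A (T.g i) = 0) (j m : ℕ) : T.IsCocycle m (cochain a l j) := by
  intro c _
  rw [cochain_d]
  refine Finset.sum_eq_zero fun t _ => ?_
  rw [h _ (List.get_mem _ _), cochain_apply, zero_mul, smul_zero]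

theorem hhOp_mulOp_mul_hh (b : B) {m : ℕ} {γ : Tot n B →ₗ[B] A} (h : T.IsCocycle m γ) :
    T.hhOp (T.mulOp b) * T.hh m γ = T.hh m (algebraMap B A b • γ) := by
  rw [hhOp_mul_hh _ h]
  refine hh_congr (zero_add m) ((T.mulOp b).isCocycle_comp h) (h.smul _) fun c _ => ?_
  rw [LinearMap.comp_apply, mulOp_apply, map_smul, Algebra.smul_def]
  rfl

theorem hhOp_shiftOp_mul_hh {m : ℕ} {a : A} {l : List (Fin n)}
    (h : ∀ i ∈ l, a * algebraMap B A (T.g i) = 0) (j : ℕ) :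
    T.hhOp T.shiftOp * T.hh m (cochain a l j) = T.hh (2 + m) (cochain a l (j + 1)) :=
  hhOp_mul_hh _ (cochain_isCocycle h j m)

theorem hhOp_shiftOp_pow (j : ℕ) :
    T.hhOp T.shiftOp ^ j = T.hh (2 * j) (cochain 1 [] j) := by
  induction j with
  | zero => rw [pow_zero, cochain_nil_zero, ← hh_aug (T := T)]
  | succ j ih =>
    rw [pow_succ', ih, hhOp_shiftOp_mul_hh (by simp), mul_add, add_comm, mul_one]

theorem hhOp_mulOp_comm (b : B) {m : ℕ} (φ : T.ClosedOp m) :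
    T.hhOp (T.mulOp b) * T.hhOp φ = T.hhOp φ * T.hhOp (T.mulOp b) :=
  hhOp_mul_hhOp_comm _ _ fun c => by simp only [mulOp_apply, map_smul]

/-- The coboundary of the form `cochain a l j` vanishes in cohomology. The hypothesis makes each of
its terms a cocycle. -/
theorem sum_hh_cochain_eq_zero (a : A) (l : List (Fin n)) (j m : ℕ)
    (h : ∀ t : Fin l.length, ∀ i ∈ l.eraseIdx t,
      a * algebraMap B A (T.g (l.get t)) * algebraMap B A (T.g i) = 0) :
    ∑ t : Fin l.length, (-1 : ℤ) ^ (t : ℕ) •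
      T.hh (m + 1) (cochain (a * algebraMap B A (T.g (l.get t))) (l.eraseIdx t) (j + 1)) = 0 := by
  have h1 : ∀ t : Fin l.length, (-1 : ℤ) ^ (t : ℕ) •
      T.hh (m + 1) (cochain (a * algebraMap B A (T.g (l.get t))) (l.eraseIdx t) (j + 1)) =
      T.hh (m + 1) (cochain ((-1) ^ (t : ℕ) * (a * algebraMap B A (T.g (l.get t))))
        (l.eraseIdx t) (j + 1)) := by
    intro t
    have hc := cochain_isCocycle (h t) (j + 1) (m + 1)
    rcases Nat.even_or_odd (t : ℕ) with ht | ht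
    · rw [ht.neg_one_pow, ht.neg_one_pow, one_smul, one_mul]
    · rw [ht.neg_one_pow, ht.neg_one_pow, neg_one_smul, neg_eq_iff_add_eq_zero]
      have hc' : T.IsCocycle (m + 1) (cochain (-1 * (a * algebraMap B A (T.g (l.get t))))
        (l.eraseIdx t) (j + 1)) := cochain_isCocycle
          (fun i hi => by rw [mul_assoc, h t i hi, mul_zero]) _ _
      rw [← hh_add hc hc', ← smul_cochain (-1)]
      have h0 : cochain (B := B) (a * algebraMap B A (T.g (l.get t))) (l.eraseIdx t) (j + 1) +
          (-1 : A) • cochain (a * algebraMap B A (T.g (l.get t))) (l.eraseIdx t) (j + 1) = 0 := by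
        ext c
        rw [LinearMap.add_apply, LinearMap.smul_apply, smul_eq_mul, neg_one_mul, add_neg_cancel,
          LinearMap.zero_apply]
      rw [h0, hh_zero]
  have hco : ∀ t ∈ (Finset.univ : Finset (Fin l.length)), T.IsCocycle (m + 1)
      (cochain ((-1) ^ (t : ℕ) * (a * algebraMap B A (T.g (l.get t)))) (l.eraseIdx t) (j + 1)) :=
    fun t _ =>
    cochain_isCocycle (fun i hi => by rw [mul_assoc, h t i hi, mul_zero]) _ _
  rw [Finset.sum_congr rfl fun t _ => h1 t, ← hh_sum _ _ hco, hh,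
    classOf_eq (IsCocycle.sum _ _ hco), cocycleClass_eq_zero _ (cochain a l j), map_zero]
  intro c _
  rw [cochain_d, LinearMap.sum_apply]
  refine Finset.sum_congr rfl fun t _ => ?_
  rw [cochain_apply, cochain_apply, mul_assoc, zsmul_eq_mul]
  push_cast
  rfl

end TateData

namespace HypersurfaceData

open TateData

variable {x : Fin n → A} (D : HypersurfaceData (B := B) x)

/-- The chain map which represents the class `Y_i`. The operator `y_i ι_i` commutes with the
differential only up to `y_i g_i s`, and the second term corrects this, by
`y_i g_i = ∑_{j < i} z_j g_j`. The grading involution turns anticommuting operators into commuting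
ones. -/
def yOp (i : Fin n) : D.ClosedOp 1 where
  toFun := LinearMap.pi fun l =>
    D.y i • (contr i ∘ₗ twist ∘ₗ LinearMap.proj l) -
      wedgeW (fun j => if j < i then D.g j else 0) ∘ₗ twist ∘ₗ LinearMap.proj (l + 1)
  homog m c hc l I h := by
    have hc' : (fun l => twist (c l)) ∈ degPart n B (m + 1) := by
      intro l I hI
      change (-1 : ℤ) ^ I.card • c l I = 0
      rw [hc l I (by lia), smul_zero]
    simp only [LinearMap.pi_apply, LinearMap.sub_apply, LinearMap.smul_apply, LinearMap.comp_apply,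
      LinearMap.proj_apply, Pi.sub_apply, Pi.smul_apply, wedgeW_apply, Finset.sum_apply]
    rw [contr_eq_zero_of_degree hc' i l I h, smul_zero, zero_sub, neg_eq_zero]
    refine Finset.sum_eq_zero fun j _ => ?_
    rw [wedge_eq_zero_of_degree hc' j l I h, smul_zero]
  comm c := by
    ext l : 1
    simp only [LinearMap.pi_apply, LinearMap.sub_apply, LinearMap.smul_apply, LinearMap.comp_apply,
      LinearMap.proj_apply, d_apply, map_add, map_sub, map_smul, twist_koszulD, twist_wedgeW,
      map_neg, contr_koszulD, contr_wedgeW, koszulD_wedgeW, ← D.y_mul_g,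
      wedgeW_wedgeW D.g (fun j => if j < i then D.g j else 0), mul_smul]
    ext I
    simp only [Pi.add_apply, Pi.sub_apply, Pi.neg_apply, Pi.smul_apply, smul_eq_mul]
    ring

theorem yOp_apply (i : Fin n) (c : Tot n B) (l : ℕ) : (D.yOp i).toFun c l =
    D.y i • contr i (twist (c l)) -
      wedgeW (fun j => if j < i then D.g j else 0) (twist (c (l + 1))) := rfl

theorem x_mul_algebraMap_g (hx : ∏ i, x i = 0) (i : Fin n) :
    x i * algebraMap B A (D.g i) = 0 := by
  rw [D.algebraMap_g, Finset.mul_prod_erase _ _ (Finset.mem_univ i), hx]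

/-- The correction term of `yOp` does not contribute, since the form is annihilated by the images of
the `g_j`. -/
theorem hhOp_yOp_mul_hh (i : Fin n) {m : ℕ} {a : A} {l : List (Fin n)}
    (h : ∀ i ∈ l, a * algebraMap B A (D.g i) = 0) (j : ℕ) (hx : ∏ i, x i = 0) :
    D.hhOp (D.yOp i) * D.hh m (cochain a l j) =
      D.hh (1 + m) (cochain ((-1) ^ (l.length + 1) * (x i * a)) (i :: l) j) := by
  rw [hhOp_mul_hh _ (cochain_isCocycle h j m)]
  refine hh_congr rfl ((D.yOp i).isCocycle_comp (cochain_isCocycle h j m))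
    (cochain_isCocycle ?_ _ _) fun c _ => ?_
  · intro i' hi'
    rcases List.mem_cons.mp hi' with rfl | hi'
    · linear_combination (-1) ^ (l.length + 1) * a * D.x_mul_algebraMap_g hx i'
    · linear_combination (-1) ^ (l.length + 1) * x i * h i' hi'
  · rw [LinearMap.comp_apply, cochain_apply, yOp_apply, map_sub, map_smul, ← coord_cons,
      coord_twist, coord_wedgeW, cochain_apply, List.length_cons, map_sub, mul_sub, smul_eq_mul,
      map_mul, D.algebraMap_y, map_zsmul, map_sum, Finset.mul_sum, Finset.sum_eq_zero, sub_zero,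
      zsmul_eq_mul]
    · push_cast; ring
    · intro t _
      rw [map_zsmul, map_mul, mul_smul_comm, ← mul_assoc]
      split_ifs
      · rw [h _ (List.get_mem _ _), zero_mul, smul_zero]
      · rw [map_zero, mul_zero, zero_mul, smul_zero]

theorem yOp_shiftOp_comm (i : Fin n) :
    D.hhOp (D.yOp i) * D.hhOp D.shiftOp = D.hhOp D.shiftOp * D.hhOp (D.yOp i) :=
  hhOp_mul_hhOp_comm _ _ fun _ => rfl

variable (x) in
/-- The product of the `x_i` along a list. -/
abbrev listProd (l : List (Fin n)) : A := (l.map x).prod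

theorem listProd_cons (i : Fin n) (l : List (Fin n)) :
    listProd x (i :: l) = x i * listProd x l := by
  rw [listProd, List.map_cons, List.prod_cons]

theorem listProd_mul_g (hx : ∏ i, x i = 0) {l : List (Fin n)} {i : Fin n} (h : i ∈ l) :
    listProd x l * algebraMap B A (D.g i) = 0 := by
  obtain ⟨b, hb⟩ : x i ∣ listProd x l := List.dvd_prod (List.mem_map_of_mem h)
  rw [hb, mul_right_comm, D.x_mul_algebraMap_g hx, zero_mul]

/-- A product of classes `X_i` and `Y_i`, in the order of a list `l`, and of a power of the class
`Z`: all the `x_i` with `i ∈ l` appear in the coefficient, and the `Y_i` determine the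
coordinate. -/
theorem prod_word (hx : ∏ i, x i = 0) (s : Fin n → Bool) (l : List (Fin n)) (j : ℕ) :
    (l.map fun i => if s i then D.hhOp (D.yOp i) else D.hhOp (D.mulOp (D.y i))).prod *
      D.hhOp D.shiftOp ^ j =
      D.hh ((l.filter s).length + 2 * j)
        (cochain (prodSign (l.filter s).length * listProd x l) (l.filter s) j) := by
  induction l with
  | nil => rw [hhOp_shiftOp_pow]; simp [prodSign, listProd]
  | cons i l ih =>
    have h : ∀ i ∈ l.filter s, prodSign (l.filter s).length * listProd x l *
        algebraMap B A (D.g i) = 0 := fun i hi => by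
      rw [mul_assoc, D.listProd_mul_g hx (List.mem_of_mem_filter hi), mul_zero]
    rw [List.map_cons, List.prod_cons, mul_assoc, ih]
    split_ifs with hi
    · rw [D.hhOp_yOp_mul_hh i h j hx, List.filter_cons_of_pos hi, listProd_cons,
        List.length_cons, prodSign]
      push_cast
      have e1 : 1 + ((l.filter s).length + 2 * j) = (l.filter s).length + 1 + 2 * j := by lia
      have e2 : (-1) ^ ((l.filter s).length + 1) *
          (x i * (prodSign (l.filter s).length * listProd x l)) =
          (-1) ^ ((l.filter s).length + 1) * prodSign (l.filter s).length *
            (x i * listProd x l) := by ring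
      rw [e1, e2]
    · rw [hhOp_mulOp_mul_hh _ (cochain_isCocycle h _ _), List.filter_cons_of_neg hi,
        listProd_cons, smul_cochain, D.algebraMap_y]
      congr 2
      ring

theorem prod_yOp (hx : ∏ i, x i = 0) (l : List (Fin n)) (j : ℕ) :
    (l.map fun i => D.hhOp (D.yOp i)).prod * D.hhOp D.shiftOp ^ j =
      D.hh (l.length + 2 * j) (cochain (prodSign l.length * listProd x l) l j) := by
  have := D.prod_word hx (fun _ => true) l j
  simpa using this

theorem prod_mulOp (l : List (Fin n)) {m : ℕ} {γ : Tot n B →ₗ[B] A} (h : D.IsCocycle m γ) :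
    (l.map fun i => D.hhOp (D.mulOp (D.y i))).prod * D.hh m γ = D.hh m (listProd x l • γ) := by
  induction l with
  | nil => simp [listProd]
  | cons i l ih =>
    rw [List.map_cons, List.prod_cons, mul_assoc, ih, hhOp_mulOp_mul_hh _ (h.smul _), smul_smul,
      D.algebraMap_y, listProd_cons]

theorem yOp_anticomm (hx : ∏ i, x i = 0) (i j : Fin n) :
    D.hhOp (D.yOp i) * D.hhOp (D.yOp j) = -(D.hhOp (D.yOp j) * D.hhOp (D.yOp i)) := by
  have h1 := D.prod_yOp hx [i, j] 0
  have h2 := D.prod_yOp hx [j, i] 0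
  simp only [List.map_cons, List.map_nil, List.prod_cons, List.prod_nil, mul_one, pow_zero] at h1 h2
  rw [h1, h2, eq_neg_iff_add_eq_zero]
  have hc : ∀ l, D.IsCocycle (l.length + 2 * 0)
      (cochain (prodSign l.length * listProd x l) l 0) := fun l =>
    cochain_isCocycle (fun i hi => by rw [mul_assoc, D.listProd_mul_g hx hi, mul_zero]) _ _
  refine (hh_add (hc [i, j]) (hc [j, i])).symm.trans ?_
  rw [← hh_zero (T := D.toTateData) (m := 2)]
  refine hh_congr rfl ((hc [i, j]).add (hc [j, i])) isCocycle_zero fun c _ => ?_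
  rw [LinearMap.add_apply, cochain_apply, cochain_apply, coord_cons, coord_cons, coord_cons,
    coord_cons, contr_contr, map_neg, map_neg]
  simp only [List.length_cons, List.length_nil, listProd, List.map_cons, List.map_nil,
    List.prod_cons, List.prod_nil, LinearMap.zero_apply]
  ring

theorem yOp_sq (hx : ∏ i, x i = 0) (i : Fin n) : D.hhOp (D.yOp i) ^ 2 = 0 := by
  have h1 := D.prod_yOp hx [i, i] 0
  simp only [List.map_cons, List.map_nil, List.prod_cons, List.prod_nil, mul_one, pow_zero,
    ← pow_two] at h1
  rw [h1, ← hh_zero (T := D.toTateData) (m := 2)]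
  refine hh_congr rfl (cochain_isCocycle
    (fun i hi => by rw [mul_assoc, D.listProd_mul_g hx hi, mul_zero]) _ _) isCocycle_zero
    fun c _ => ?_
  rw [cochain_apply, coord_cons, coord_cons, contr_self, map_zero, map_zero, mul_zero]
  rfl

theorem prod_ofFn_eq_zero (hx : ∏ i, x i = 0) (s : Fin n → Bool) :
    (List.ofFn fun i => if s i then D.hhOp (D.yOp i) else D.hhOp (D.mulOp (D.y i))).prod = 0 := by
  have h := D.prod_word hx s (List.finRange n) 0
  rw [pow_zero, mul_one, ← List.ofFn_eq_map] at h
  have h0 : listProd x (List.finRange n) = 0 := by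
    rw [listProd, ← List.ofFn_eq_map, List.prod_ofFn, hx]
  rw [h, h0, mul_zero (_ : A), cochain_zero, hh_zero]

theorem listProd_sort (s : Finset (Fin n)) : listProd x (s.sort (· ≤ ·)) = ∏ i ∈ s, x i := by
  rw [listProd, ← List.prod_toFinset _ (Finset.sort_nodup _ _), Finset.sort_toFinset]

/-- Leaving out an entry of the increasing enumeration of a finite set. -/
theorem sort_eraseIdx (I : Finset (Fin n)) (t : Fin (I.sort (· ≤ ·)).length) :
    (I.sort (· ≤ ·)).eraseIdx t = (I.erase ((I.sort (· ≤ ·)).get t)).sort (· ≤ ·) := by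
  have h := (Finset.sort_nodup I (· ≤ ·)).erase_get t
  have hf : ((I.sort (· ≤ ·)).erase ((I.sort (· ≤ ·)).get t)).toFinset =
      I.erase ((I.sort (· ≤ ·)).get t) := by
    ext j
    rw [List.mem_toFinset, (Finset.sort_nodup I _).mem_erase_iff, Finset.mem_erase,
      Finset.mem_sort]
  rw [← h, ← hf]
  exact ((List.toFinset_sort (· ≤ ·) ((Finset.sort_nodup _ _).erase _)).mpr
    ((Finset.pairwise_sort I _).sublist List.erase_sublist)).symm

theorem prod_compl_mul_prod_erase {I : Finset (Fin n)} {i : Fin n} (hi : i ∈ I) :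
    (∏ j ∈ Iᶜ, x j) * ∏ j ∈ I.erase i, x j = ∏ j ∈ Finset.univ.erase i, x j := by
  rw [← Finset.prod_union]
  · congr 1
    ext j
    by_cases hj : j = i
    · simp [hj, hi]
    · simp [hj, em']
  · exact Finset.disjoint_of_subset_right (Finset.erase_subset _ _) disjoint_compl_left

/-- The relation which comes from the coboundary of the coordinate form of `e_I`. -/
theorem boundary_eq_zero (hx : ∏ i, x i = 0) {I : Finset (Fin n)} (hI : I.Nonempty) :
    ((Iᶜ.sort (· ≤ ·)).map fun i => D.hhOp (D.mulOp (D.y i))).prod *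
      (∑ j ∈ Finset.range I.card, (-1) ^ j *
        (((I.sort (· ≤ ·)).eraseIdx j).map fun i => D.hhOp (D.yOp i)).prod) *
      D.hhOp D.shiftOp = 0 := by
  obtain ⟨p, hp⟩ : ∃ p, I.card = p + 1 := ⟨I.card - 1, by have := hI.card_pos; lia⟩
  set l := I.sort (· ≤ ·) with hl
  have hlen : l.length = I.card := Finset.length_sort _
  have hlen' : ∀ t : Fin l.length, (l.eraseIdx t).length = p := fun t => by
    rw [List.length_eraseIdx_of_lt t.2, hlen, hp, Nat.add_sub_cancel]
  have hmem : ∀ t : Fin l.length, l.get t ∈ I := fun t =>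
    (Finset.mem_sort _).mp (List.get_mem l t)
  have hprod : ∀ t : Fin l.length, listProd x (Iᶜ.sort (· ≤ ·)) * listProd x (l.eraseIdx t) =
      algebraMap B A (D.g (l.get t)) := fun t => by
    rw [D.algebraMap_g, ← prod_compl_mul_prod_erase (hmem t), listProd_sort]
    exact congrArg _ ((congrArg _ (sort_eraseIdx I t)).trans (listProd_sort _))
  have hcoc : ∀ t : Fin l.length, ∀ i ∈ l.eraseIdx t,
      (prodSign p : A) * algebraMap B A (D.g (l.get t)) * algebraMap B A (D.g i) = 0 := by
    intro t i hi
    rw [← hprod t, mul_assoc, mul_assoc, D.listProd_mul_g hx hi, mul_zero, mul_zero]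
  rw [← sum_hh_cochain_eq_zero (prodSign p : A) l 0 (p + 1) hcoc, ← hlen, Finset.mul_sum,
    Finset.sum_mul, ← Fin.sum_univ_eq_sum_range (n := l.length) (f := fun j => _ * (_ *
    ((l.eraseIdx j).map fun i => D.hhOp (D.yOp i)).prod) * _)]
  refine Finset.sum_congr rfl fun t _ => ?_
  have h := D.prod_yOp hx (l.eraseIdx t) 1
  rw [pow_one, hlen'] at h
  have hc : ((-1) ^ (t : ℕ) : ⨁ m, Ext.{u} (ModuleCat.of B A) (ModuleCat.of B A) m) =
      (((-1) ^ (t : ℕ) : ℤ) : ⨁ m, Ext.{u} (ModuleCat.of B A) (ModuleCat.of B A) m) := by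
    push_cast; rfl
  have hcoc' : D.IsCocycle (p + 2 * 1)
      (cochain (prodSign p * listProd x (l.eraseIdx t)) (l.eraseIdx t) 1) :=
    cochain_isCocycle (fun i hi => by rw [mul_assoc, D.listProd_mul_g hx hi, mul_zero]) _ _
  rw [hc, ← zsmul_eq_mul, mul_smul_comm, smul_mul_assoc, mul_assoc, h, prod_mulOp _ _ hcoc',
    smul_cochain, mul_left_comm, hprod]

end HypersurfaceData

end Koszul

/-! ### The presented algebra and its universal property -/

namespace HHPresentation

open Koszul

variable {n : ℕ}

/-- Elements `X_i`, `Y_i`, `Z` of a ring which satisfy the defining relations of the presented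
algebra. -/
structure IsSolution {R : Type*} [Ring R] (X Y : Fin n → R) (Z : R) : Prop where
  X_comm_X : ∀ i j, X i * X j = X j * X i
  X_comm_Y : ∀ i j, X i * Y j = Y j * X i
  X_comm_Z : ∀ i, X i * Z = Z * X i
  Y_comm_Z : ∀ i, Y i * Z = Z * Y i
  Y_anticomm : ∀ i j, Y i * Y j = -(Y j * Y i)
  Y_sq : ∀ i, Y i ^ 2 = 0
  monomial : ∀ s : Fin n → Bool, (List.ofFn fun i => if s i then Y i else X i).prod = 0
  boundary : ∀ I : Finset (Fin n), I.Nonempty →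
    ((Iᶜ.sort (· ≤ ·)).map X).prod * (∑ j ∈ Finset.range I.card,
      (-1) ^ j * (((I.sort (· ≤ ·)).eraseIdx j).map Y).prod) * Z = 0

section lift

variable {k : Type u} [Field k] {R : Type*} [Ring R] [Algebra k R]

/-- The values of the variables which are given by elements `X_i`, `Y_i`, `Z`. -/
def Gen.elim {R : Type*} (X Y : Fin n → R) (Z : R) : Gen n → R
  | .X i => X i
  | .Y i => Y i
  | .Z => Z

/-- The homomorphism on the graded commutative polynomial ring which is given by a solution. -/
def IsSolution.liftPoly {X Y : Fin n → R} {Z : R} (h : IsSolution X Y Z) :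
    GradedCommPoly k n →ₐ[k] R :=
  RingQuot.liftAlgHom k ⟨FreeAlgebra.lift k (Gen.elim X Y Z), by
    rintro _ _ ⟨a, b⟩
    have hn : ((-1 : FreeAlgebra k (Gen n)) ^ (a.deg * b.deg)) =
      algebraMap k _ ((-1) ^ (a.deg * b.deg)) := by simp
    rw [hn]
    simp only [map_mul, FreeAlgebra.lift_ι_apply, AlgHom.commutes]
    cases a <;> cases b <;> simp only [Gen.elim, Gen.deg, mul_zero, zero_mul, pow_zero, map_one,
      one_mul, mul_one, map_pow, map_neg, pow_one, even_two, Even.neg_pow, one_pow, h.X_comm_X,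
      h.X_comm_Y, h.X_comm_Z, h.Y_comm_Z]
    · rw [neg_one_mul]; exact h.Y_anticomm _ _
    · rw [Even.neg_one_pow (by decide), one_mul]⟩

variable {X Y : Fin n → R} {Z : R} (h : IsSolution X Y Z)

theorem IsSolution.liftPoly_var (g : Gen n) :
    h.liftPoly (k := k) (var k g) = Gen.elim X Y Z g := by
  rw [liftPoly, var, RingQuot.liftAlgHom_mkAlgHom_apply]
  exact FreeAlgebra.lift_ι_apply _ _

theorem IsSolution.relationIdeal_le :
    relationIdeal k n ≤ TwoSidedIdeal.ker (h.liftPoly (k := k)) := by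
  have hX : ∀ l, h.liftPoly (prodX k l) = (l.map X).prod := fun l => by
    rw [prodX, map_list_prod, List.map_map]
    exact congrArg List.prod (List.map_congr_left fun i _ => h.liftPoly_var (Gen.X i))
  have hY : ∀ l, h.liftPoly (prodY k l) = (l.map Y).prod := fun l => by
    rw [prodY, map_list_prod, List.map_map]
    exact congrArg List.prod (List.map_congr_left fun i _ => h.liftPoly_var (Gen.Y i))
  rw [relationIdeal, TwoSidedIdeal.span_le]
  rintro r ((⟨a, ha, rfl⟩ | ⟨i, rfl⟩) | ⟨I, hI, rfl⟩)
  · rw [SetLike.mem_coe, TwoSidedIdeal.mem_ker, map_list_prod, List.map_ofFn]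
    classical
    refine Eq.trans ?_ (h.monomial fun i => decide (a i = Gen.Y i))
    congr 2
    ext i
    rw [Function.comp_apply, h.liftPoly_var]
    rcases ha i with hi | hi <;> simp [hi, Gen.elim]
  · rw [SetLike.mem_coe, TwoSidedIdeal.mem_ker, map_pow, h.liftPoly_var]
    exact h.Y_sq i
  · rw [SetLike.mem_coe, TwoSidedIdeal.mem_ker, map_mul, map_mul, hX, map_sum, h.liftPoly_var]
    simp only [map_mul, map_pow, map_neg, map_one, hY]
    exact h.boundary I hI

/-- The homomorphism on the presented algebra which is given by a solution of the relations. -/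
def IsSolution.lift : PresentedAlgebra k n →ₐ[k] R :=
  (relationIdeal k n).ringCon.liftₐ h.liftPoly fun a b hab => by
    have := h.relationIdeal_le (k := k) ((TwoSidedIdeal.rel_iff _ _ _).mp hab)
    rw [TwoSidedIdeal.mem_ker, map_sub, sub_eq_zero] at this
    exact this

variable (k) in
/-- The class of a variable in the presented algebra. -/
def gen (g : Gen n) : PresentedAlgebra k n := (relationIdeal k n).ringCon.mkₐ k (var k g)

theorem IsSolution.lift_gen (g : Gen n) : h.lift (k := k) (gen k g) = Gen.elim X Y Z g :=
  h.liftPoly_var g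

end lift

section generators

variable (k : Type u) [Field k]

theorem mk_eq_zero {r : GradedCommPoly k n} (hr : r ∈ monomialRelations k n ∪ squareRelations k n ∪
    boundaryRelations k n) : (relationIdeal k n).ringCon.mkₐ k r = 0 := by
  have h : r ∈ relationIdeal k n := TwoSidedIdeal.subset_span hr
  rw [← map_zero ((relationIdeal k n).ringCon.mkₐ k)]
  exact (RingCon.eq _).mpr ((TwoSidedIdeal.rel_iff _ _ _).mpr (by rwa [sub_zero]))

theorem gen_comm (a b : Gen n) :
    gen k a * gen k b = (-1) ^ (a.deg * b.deg) * (gen k b * gen k a) := by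
  have h := RingQuot.mkAlgHom_rel k (GradedCommRel.comm (k := k) a b)
  have hn : ((-1 : FreeAlgebra k (Gen n)) ^ (a.deg * b.deg)) =
      algebraMap k _ ((-1) ^ (a.deg * b.deg)) := by simp
  rw [hn, map_mul, map_mul, map_mul, AlgHom.commutes] at h
  have h2 := congrArg ((relationIdeal k n).ringCon.mkₐ k) h
  rw [map_mul, map_mul, map_mul, AlgHom.commutes] at h2
  refine h2.trans ?_
  simp only [map_pow, map_neg, map_one]
  rfl

theorem isSolution_gen :
    IsSolution (fun i => gen k (Gen.X i : Gen n)) (fun i => gen k (Gen.Y i)) (gen k Gen.Z) where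
  X_comm_X i j := by simpa [Gen.deg] using gen_comm k (Gen.X i) (Gen.X j)
  X_comm_Y i j := by simpa [Gen.deg] using gen_comm k (Gen.X i) (Gen.Y j)
  X_comm_Z i := by simpa [Gen.deg] using gen_comm k (Gen.X i) Gen.Z
  Y_comm_Z i := by simpa [Gen.deg] using gen_comm k (Gen.Y i) Gen.Z
  Y_anticomm i j := by simpa [Gen.deg] using gen_comm k (Gen.Y i) (Gen.Y j)
  Y_sq i := by
    have := mk_eq_zero k (r := var k (Gen.Y i) ^ 2) (.inl (.inr ⟨i, rfl⟩))
    rwa [map_pow] at this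
  monomial s := by
    have := mk_eq_zero k (.inl (.inl ⟨fun i => if s i then Gen.Y i else Gen.X i, fun i => by
      by_cases h : s i <;> simp [h], rfl⟩))
    rw [map_list_prod, List.map_ofFn] at this
    refine Eq.trans ?_ this
    congr 2
    ext i
    exact (apply_ite (gen k) (s i = true) (Gen.Y i) (Gen.X i)).symm
  boundary I hI := by
    have := mk_eq_zero k (.inr ⟨I, hI, rfl⟩)
    simp only [map_mul, map_sum, map_pow, map_neg, map_one, prodX, prodY, map_list_prod,
      List.map_map] at this
    exact this

theorem adjoin_range_gen :
    Algebra.adjoin k (Set.range (gen k : Gen n → PresentedAlgebra k n)) = ⊤ := by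
  rw [eq_top_iff]
  rintro r -
  obtain ⟨r, rfl⟩ := RingCon.mkₐ_surjective (α := k) (c := (relationIdeal k n).ringCon) r
  obtain ⟨r, rfl⟩ := RingQuot.mkAlgHom_surjective k (GradedCommRel k n) r
  induction r using FreeAlgebra.induction with
  | grade0 a => rw [AlgHom.commutes, AlgHom.commutes]; exact Subalgebra.algebraMap_mem _ _
  | grade1 g => exact Algebra.subset_adjoin ⟨g, rfl⟩
  | mul a b ha hb => rw [map_mul, map_mul]; exact mul_mem ha hb
  | add a b ha hb => rw [map_add, map_add]; exact add_mem ha hb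

theorem gen_X_mem_center (i : Fin n) :
    gen k (Gen.X i) ∈ Subalgebra.center k (PresentedAlgebra k n) := by
  rw [Subalgebra.mem_center_iff]
  intro b
  have hb : b ∈ Algebra.adjoin k (Set.range (gen k : Gen n → PresentedAlgebra k n)) := by
    rw [adjoin_range_gen]; trivial
  induction hb using Algebra.adjoin_induction with
  | mem b hb =>
    obtain ⟨g, rfl⟩ := hb
    have := gen_comm k (Gen.X i) g
    simpa [Gen.deg] using this.symm
  | algebraMap r => exact Algebra.commutes _ _
  | add a b _ _ ha hb => rw [add_mul, mul_add, ha, hb]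
  | mul a b _ _ ha hb => rw [mul_assoc, hb, ← mul_assoc, ha, mul_assoc]

end generators

end HHPresentation

/-! ### Normal forms in the presented algebra -/

namespace HHPresentation

open Koszul MvPolynomial

variable {n : ℕ} {k : Type u} [Field k] {R : Type*} [Ring R] [Algebra k R]

/-- The product of the elements `Y_i` over the members of a finite set, in increasing order. -/
def setProd (Y : Fin n → R) (I : Finset (Fin n)) : R := ((I.sort (· ≤ ·)).map Y).prod

theorem setProd_empty (Y : Fin n → R) : setProd Y ∅ = 1 := by simp [setProd]

theorem setProd_insert_of_lt (Y : Fin n → R) {a : Fin n} {s : Finset (Fin n)}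
    (h : ∀ b ∈ s, a < b) : setProd Y (insert a s) = Y a * setProd Y s := by
  rw [setProd, setProd, Finset.sort_insert _ (fun b hb => (h b hb).le)
    (fun ha => lt_irrefl a (h a ha)), List.map_cons, List.prod_cons]

/-- The product of `Y_i` with `Y_I` is a multiple of `Y_{I ∪ i}`: the factor is a sign if `i ∉ I`,
and it may be taken to be zero if `i ∈ I`. -/
theorem exists_mul_setProd {Y : Fin n → R} (hanti : ∀ i j, Y i * Y j = -(Y j * Y i))
    (hsq : ∀ i, Y i ^ 2 = 0) (i : Fin n) (I : Finset (Fin n)) :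
    ∃ e : ℤ, Y i * setProd Y I = e • setProd Y (insert i I) := by
  induction I using Finset.induction_on_min with
  | empty => exact ⟨1, by rw [setProd_insert_of_lt _ (by simp), one_smul]⟩
  | insert a s has ih =>
    rcases lt_trichotomy i a with h | rfl | h
    · refine ⟨1, ?_⟩
      rw [one_smul, setProd_insert_of_lt Y (s := insert a s)]
      intro b hb
      rcases Finset.mem_insert.mp hb with rfl | hb
      · exact h
      · exact h.trans (has b hb)
    · refine ⟨0, ?_⟩
      rw [setProd_insert_of_lt _ has, ← mul_assoc, ← pow_two, hsq, zero_mul, zero_smul]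
    · obtain ⟨e, he⟩ := ih
      refine ⟨-e, ?_⟩
      rw [setProd_insert_of_lt _ has, ← mul_assoc, hanti, neg_mul, mul_assoc, he, mul_smul_comm,
        Finset.insert_comm, setProd_insert_of_lt _ (s := insert i s), neg_smul]
      intro b hb
      rcases Finset.mem_insert.mp hb with rfl | hb
      · exact h
      · exact has b hb

/-- The signs in the presentation, in terms of lists and in terms of finite sets. -/
theorem sum_sgn_smul {M : Type*} [AddCommGroup M] {l : List (Fin n)} (hl : l.Pairwise (· < ·))
    (F : Fin n → M) : ∑ i ∈ l.toFinset, sgn i l.toFinset • F i =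
      ∑ t : Fin l.length, (-1 : ℤ) ^ (t : ℕ) • F (l.get t) := by
  induction l with
  | nil => simp
  | cons a l ih =>
    rw [List.pairwise_cons] at hl
    have ha : a ∉ l.toFinset := fun h => lt_irrefl a (hl.1 a (List.mem_toFinset.mp h))
    have h1 : sgn a l.toFinset = 1 := by
      rw [sgn, Finset.filter_false_of_mem, Finset.card_empty, pow_zero]
      exact fun j hj => (hl.1 j (List.mem_toFinset.mp hj)).not_gt
    rw [List.toFinset_cons, Finset.sum_insert ha, sgn_insert_self, h1]
    change _ = ∑ t : Fin (l.length + 1), _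
    rw [Fin.sum_univ_succ]
    refine congrArg₂ _ ?_ ?_
    · simp
    · trans -∑ i ∈ l.toFinset, sgn i l.toFinset • F i
      · rw [← Finset.sum_neg_distrib]
        refine Finset.sum_congr rfl fun i hi => ?_
        rw [sgn_insert ha, if_pos (hl.1 i (List.mem_toFinset.mp hi)), neg_one_mul, neg_smul]
      · rw [ih hl.2, ← Finset.sum_neg_distrib]
        refine Finset.sum_congr rfl fun t _ => ?_
        simp [pow_succ]

variable {X : Fin n → R} (hX : ∀ i, X i ∈ Subalgebra.center k R)

/-- The evaluation of polynomials at central elements `X_i` of a noncommutative ring. -/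
def polyHom : MvPolynomial (Fin n) k →ₐ[k] R :=
  (Subalgebra.center k R).val.comp (aeval fun i => ⟨X i, hX i⟩)

theorem polyHom_X (i : Fin n) : polyHom hX (MvPolynomial.X i) = X i := by simp [polyHom]

theorem polyHom_comm (p : MvPolynomial (Fin n) k) (r : R) :
    r * polyHom hX p = polyHom hX p * r :=
  Subalgebra.mem_center_iff.mp (aeval (R := k) (fun i => (⟨X i, hX i⟩ :
    Subalgebra.center k R)) p).2 r

theorem polyHom_prod (s : Finset (Fin n)) :
    polyHom hX (∏ i ∈ s, MvPolynomial.X i) = ((s.sort (· ≤ ·)).map X).prod := by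
  conv_lhs => rw [← Finset.sort_toFinset (r := (· ≤ ·)) (s := s)]
  rw [List.prod_toFinset _ (Finset.sort_nodup _ _), map_list_prod, List.map_map]
  refine congrArg List.prod (List.map_congr_left fun i _ => polyHom_X hX i)

theorem prod_map_ite (Y : Fin n → R) (s : Fin n → Bool) (l : List (Fin n)) :
    (l.map fun i => if s i then Y i else X i).prod =
      polyHom hX (l.map fun i => if s i then 1 else MvPolynomial.X i).prod *
        ((l.filter s).map Y).prod := by
  induction l with
  | nil => simp
  | cons i l ih =>
    rw [List.map_cons, List.prod_cons, ih, List.map_cons, List.prod_cons]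
    split_ifs with h
    · rw [List.filter_cons_of_pos h, List.map_cons, List.prod_cons, one_mul, ← mul_assoc,
        polyHom_comm, mul_assoc]
    · rw [List.filter_cons_of_neg h, map_mul, polyHom_X, mul_assoc]

variable (Y : Fin n → R) (Z : R)

/-- The sum of the terms `τ_{j,I}(X) Y_I Z^j` over the numbers `j < L` and the subsets `I` of the
index set. -/
def normalForm (L : ℕ) (τ : ℕ → Finset (Fin n) → MvPolynomial (Fin n) k) : R :=
  ∑ j ∈ Finset.range L, ∑ I, polyHom hX (τ j I) * setProd Y I * Z ^ j

theorem normalForm_sub (L : ℕ) (τ τ' : ℕ → Finset (Fin n) → MvPolynomial (Fin n) k) :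
    normalForm hX Y Z L (τ - τ') = normalForm hX Y Z L τ - normalForm hX Y Z L τ' := by
  simp only [normalForm, Pi.sub_apply, map_sub, sub_mul, Finset.sum_sub_distrib]

variable {Y Z}

/-- The monomial relations, with the factors `X_i` collected in front. -/
theorem polyHom_compl_mul_setProd (h : IsSolution X Y Z) (I : Finset (Fin n)) :
    polyHom hX (∏ i ∈ Iᶜ, MvPolynomial.X i) * setProd Y I = 0 := by
  rw [← h.monomial fun i => decide (i ∈ I), List.ofFn_eq_map, prod_map_ite hX]
  congr 2
  · rw [← List.ofFn_eq_map, List.prod_ofFn, ← Finset.prod_subset (Finset.subset_univ Iᶜ)]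
    · refine Finset.prod_congr rfl fun i hi => ?_
      rw [Finset.mem_compl] at hi
      simp [hi]
    · intro i _ hi
      rw [Finset.mem_compl, not_not] at hi
      simp [hi]
  · have h1 : ((List.finRange n).filter fun i => decide (i ∈ I)).toFinset = I := by ext; simp
    conv_lhs => rw [← h1]
    rw [setProd]
    congr 2
    refine (List.toFinset_sort (· ≤ ·) ((List.nodup_finRange n).filter _)).mpr ?_
    exact (List.pairwise_le_finRange n).filter _

/-- The boundary relations in terms of finite sets. -/
theorem boundary_sgn (h : IsSolution X Y Z) {J : Finset (Fin n)} (hJ : J.Nonempty) :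
    polyHom hX (∏ i ∈ Jᶜ, MvPolynomial.X i) * (∑ i ∈ J, sgn i J • setProd Y (J.erase i)) * Z =
      0 := by
  rw [← h.boundary J hJ, polyHom_prod]
  congr 2
  have hp := sum_sgn_smul (Finset.sortedLT_sort J).pairwise fun i => setProd Y (J.erase i)
  rw [Finset.sort_toFinset] at hp
  rw [hp, ← Finset.length_sort (s := J) (· ≤ ·),
    ← Fin.sum_univ_eq_sum_range (fun j => (-1) ^ j * (((J.sort (· ≤ ·)).eraseIdx j).map Y).prod)]
  refine Finset.sum_congr rfl fun t _ => ?_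
  rw [HypersurfaceData.sort_eraseIdx, setProd, zsmul_eq_mul]
  push_cast
  rfl

/-- Every element of an algebra which is generated by a solution has a normal form. -/
theorem exists_normalForm (h : IsSolution X Y Z)
    (hgen : Algebra.adjoin k (Set.range (Gen.elim X Y Z)) = ⊤) (r : R) :
    ∃ L τ, r = normalForm hX Y Z L τ := by
  let N : Submodule k R := Submodule.span k
    {r | ∃ (p : MvPolynomial (Fin n) k) (I : Finset (Fin n)) (j : ℕ),
      r = polyHom hX p * setProd Y I * Z ^ j}
  have hZY : ∀ I, Z * setProd Y I = setProd Y I * Z := fun I => by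
    have : Commute Z (setProd Y I) := Commute.list_prod_right _ _ fun r hr => by
      obtain ⟨i, _, rfl⟩ := List.mem_map.mp hr
      exact (h.Y_comm_Z i).symm
    exact this
  -- The span of the terms contains `1` and is stable under left multiplication by the generators.
  have hmul : ∀ g, ∀ r ∈ N, Gen.elim X Y Z g * r ∈ N := by
    intro g r hr
    induction hr using Submodule.span_induction with
    | mem r hr =>
      obtain ⟨p, I, j, rfl⟩ := hr
      cases g with
      | X i =>
        refine Submodule.subset_span ⟨MvPolynomial.X i * p, I, j, ?_⟩
        rw [map_mul, polyHom_X, Gen.elim]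
        simp only [mul_assoc]
      | Y i =>
        obtain ⟨e, he⟩ := exists_mul_setProd h.Y_anticomm h.Y_sq i I
        have : Gen.elim X Y Z (Gen.Y i) * (polyHom hX p * setProd Y I * Z ^ j) =
            e • (polyHom hX p * setProd Y (insert i I) * Z ^ j) := by
          rw [Gen.elim, ← mul_assoc, ← mul_assoc, polyHom_comm, mul_assoc _ (Y i), he,
            mul_smul_comm, smul_mul_assoc]
        rw [this]
        refine zsmul_mem (Submodule.subset_span ?_) e
        exact ⟨p, insert i I, j, rfl⟩
      | Z =>
        refine Submodule.subset_span ⟨p, I, j + 1, ?_⟩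
        rw [Gen.elim, ← mul_assoc, ← mul_assoc, polyHom_comm, mul_assoc _ Z, hZY, pow_succ']
        simp only [mul_assoc]
    | zero => rw [mul_zero]; exact zero_mem _
    | add a b _ _ ha hb => rw [mul_add]; exact add_mem ha hb
    | smul c a _ ha => rw [mul_smul_comm]; exact N.smul_mem c ha
  have hmul' : ∀ a ∈ Algebra.adjoin k (Set.range (Gen.elim X Y Z)), ∀ r ∈ N, a * r ∈ N := by
    intro a ha
    induction ha using Algebra.adjoin_induction with
    | mem a ha => obtain ⟨g, rfl⟩ := ha; exact hmul g
    | algebraMap c => intro r hr; rw [← Algebra.smul_def]; exact N.smul_mem c hr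
    | add a b _ _ ha hb => intro r hr; rw [add_mul]; exact add_mem (ha r hr) (hb r hr)
    | mul a b _ _ ha hb => intro r hr; rw [mul_assoc]; exact ha _ (hb r hr)
  have h1 : (1 : R) ∈ N := by
    refine Submodule.subset_span ?_
    exact ⟨(1 : MvPolynomial (Fin n) k), ∅, 0, by simp [setProd_empty]⟩
  have hr : r ∈ N := by
    have := hmul' r (by rw [hgen]; trivial) 1 h1
    rwa [mul_one] at this
  suffices h : ∃ f : ℕ × Finset (Fin n) →₀ MvPolynomial (Fin n) k,
      r = f.sum fun q p => polyHom hX p * setProd Y q.2 * Z ^ q.1 by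
    obtain ⟨f, rfl⟩ := h
    refine ⟨f.support.sup Prod.fst + 1, fun j I => f (j, I), ?_⟩
    rw [normalForm, ← Finset.sum_product']
    refine Finsupp.sum_of_support_subset f (fun q hq => ?_) _ (by simp)
    rw [Finset.mem_product]
    exact ⟨Finset.mem_range_succ_iff.mpr (Finset.le_sup (f := Prod.fst) hq), Finset.mem_univ _⟩
  induction hr using Submodule.span_induction with
  | mem r hr =>
    obtain ⟨p, I, j, rfl⟩ := hr
    exact ⟨Finsupp.single (j, I) p, by rw [Finsupp.sum_single_index (by simp)]⟩
  | zero => exact ⟨0, by simp⟩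
  | add a b _ _ ha hb =>
    obtain ⟨f, rfl⟩ := ha
    obtain ⟨g, rfl⟩ := hb
    exact ⟨f + g, by rw [Finsupp.sum_add_index' (by simp) (by simp [add_mul])]⟩
  | smul c a _ ha =>
    obtain ⟨f, rfl⟩ := ha
    refine ⟨c • f, ?_⟩
    rw [Finsupp.sum_smul_index' (by simp), Finsupp.smul_sum]
    simp only [map_smul, smul_mul_assoc]

end HHPresentation

/-! ### Values of the comparison map on monomials -/

namespace Koszul

open HHPresentation TateData

variable {n : ℕ}

section ring

open MvPolynomial

variable {k : Type u} [Field k] {A : Type u} [CommRing A] [Algebra k A] {x : Fin n → A}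

theorem X_dvd_of_dvd_prod_erase_mul {i : Fin n} {p : MvPolynomial (Fin n) k}
    (h : X i ∣ (∏ j ∈ Finset.univ.erase i, X j) * p) : X i ∣ p := by
  refine ((X_prime (R := k) (i := i)).dvd_or_dvd h).resolve_left fun h' => ?_
  obtain ⟨j, hj, hd⟩ := (X_prime (R := k) (i := i)).exists_mem_finset_dvd h'
  rw [X_dvd_X] at hd
  exact (Finset.mem_erase.mp hj).1 hd.symm

theorem prod_X_dvd {I : Finset (Fin n)} {p : MvPolynomial (Fin n) k} (h : ∀ i ∈ I, X i ∣ p) :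
    ∏ i ∈ I, X i ∣ p := by
  refine Finset.prod_dvd_of_isRelPrime (fun i _ j _ hij => ?_) h
  exact ((X_prime (R := k) (i := i)).irreducible.isRelPrime_iff_not_dvd).mpr fun hd =>
    hij (X_dvd_X.mp hd)

/-- An element of the quotient ring is a multiple of `∏_{i ∈ I} x_i` if, for each `i ∈ I`, its
product with `∏_{j ≠ i} x_j` is a multiple of `x_i`. -/
theorem IsSquareFreeHypersurface.exists_eq_mul (H : IsSquareFreeHypersurface k x)
    {I : Finset (Fin n)} {a : A} (h : ∀ i ∈ I, x i ∣ (∏ j ∈ Finset.univ.erase i, x j) * a) :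
    ∃ p : MvPolynomial (Fin n) k, a = aeval x p * ∏ i ∈ I, x i := by
  obtain ⟨p, rfl⟩ := H.surjective a
  have hp : ∏ i ∈ I, X i ∣ p := by
    refine prod_X_dvd fun i hi => X_dvd_of_dvd_prod_erase_mul ?_
    obtain ⟨b, hb⟩ := h i hi
    obtain ⟨q, rfl⟩ := H.surjective b
    have h0 : aeval x ((∏ j ∈ Finset.univ.erase i, X j) * p - X i * q) = 0 := by
      simp only [map_sub, map_mul, map_prod, aeval_X, hb, sub_self]
    have hd := (Finset.dvd_prod_of_mem X (Finset.mem_univ i)).trans ((H.aeval_eq_zero_iff _).mp h0)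
    exact (dvd_sub_left (dvd_mul_right _ _)).mp hd
  obtain ⟨q, rfl⟩ := hp
  exact ⟨q, by simp only [map_mul, map_prod, aeval_X, mul_comm]⟩

theorem IsSquareFreeHypersurface.dvd_of_mul_eq_zero (H : IsSquareFreeHypersurface k x)
    {I : Finset (Fin n)} {p : MvPolynomial (Fin n) k} (h : aeval x p * ∏ i ∈ I, x i = 0) :
    ∏ i ∈ Iᶜ, X i ∣ p := by
  have h0 : aeval x (p * ∏ i ∈ I, X i) = 0 := by
    simpa only [map_mul, map_prod, aeval_X] using h
  have hd := (H.aeval_eq_zero_iff _).mp h0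
  rw [← Finset.prod_compl_mul_prod I] at hd
  refine (mul_dvd_mul_iff_right ?_).mp hd
  exact Finset.prod_ne_zero_iff.mpr fun i _ => X_ne_zero i

end ring

variable {B A : Type u} [CommRing B] [CommRing A] [Algebra B A] {x : Fin n → A}

/-- The basis vector of the total complex with index `I` and the `j`-th divided power. -/
def basisVec (j : ℕ) (I : Finset (Fin n)) : Tot n B := Pi.single j (Pi.single I 1)

theorem basisVec_apply (j l : ℕ) (I J : Finset (Fin n)) :
    basisVec (B := B) j I l J = if l = j ∧ J = I then 1 else 0 := by
  rw [basisVec, Pi.single_apply]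
  by_cases h : l = j
  · by_cases h' : J = I <;> simp [h, h']
  · simp [h]

theorem basisVec_mem (j : ℕ) (I : Finset (Fin n)) :
    basisVec j I ∈ degPart n B (I.card + 2 * j) := by
  intro l J h
  rw [basisVec_apply, if_neg]
  rintro ⟨rfl, rfl⟩
  exact h rfl

theorem eq_sum_basisVec {m : ℕ} {c : Tot n B} (hc : c ∈ degPart n B m) {L : ℕ} (hL : m < L) :
    c = ∑ j ∈ Finset.range L, ∑ I, c j I • basisVec j I := by
  ext l J
  simp only [Finset.sum_apply, Pi.smul_apply, basisVec_apply, smul_eq_mul, mul_ite, mul_one,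
    mul_zero, ite_and]
  rw [Finset.sum_eq_single l]
  · simp
  · intro j _ hj
    simp [hj.symm]
  · intro hl
    rw [Finset.mem_range, not_lt] at hl
    simpa using hc l J (by lia)

namespace TateData

variable (T : TateData n B A)

/-- A linear form with values in `A` on the boundary of a basis vector: the terms with the `z_i`
vanish in `A`. -/
theorem map_d_basisVec (β : Tot n B →ₗ[B] A) (j : ℕ) (I : Finset (Fin n)) :
    β (T.d (basisVec (j + 1) I)) =
      ∑ i ∈ Iᶜ, algebraMap B A (T.g i) * (sgn i I • β (basisVec j (insert i I))) := by
  have hd : T.d (basisVec (j + 1) I) =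
      ∑ i, T.z i • (Pi.single (j + 1) (contr i (Pi.single I 1)) : Tot n B) +
        ∑ i ∈ Iᶜ, T.g i • (sgn i I • basisVec j (insert i I) : Tot n B) := by
    have hw : ∀ i, (wedge i (Pi.single I (1 : B))) =
        if i ∈ I then 0 else sgn i I • Pi.single (insert i I) (1 : B) := by
      intro i
      ext J
      rw [wedge_apply]
      by_cases hi : i ∈ I
      · rw [if_pos hi, Pi.zero_apply]
        split_ifs with hJ
        · rw [Pi.single_eq_of_ne, smul_zero]
          rintro rfl
          exact Finset.notMem_erase i J hi
        · rfl
      · rw [if_neg hi, Pi.smul_apply]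
        split_ifs with hJ
        · by_cases h : J = insert i I
          · subst h
            rw [Finset.erase_insert hi, Pi.single_eq_same, Pi.single_eq_same, sgn_insert_self]
          · rw [Pi.single_eq_of_ne h, Pi.single_eq_of_ne, smul_zero, smul_zero]
            rintro rfl
            exact h (Finset.insert_erase hJ).symm
        · rw [Pi.single_eq_of_ne, smul_zero]
          rintro rfl
          exact hJ (Finset.mem_insert_self i I)
    ext l : 1
    rw [d_apply, Pi.add_apply, koszulD_apply, wedgeW_apply, Finset.sum_apply, Finset.sum_apply]
    congr 1
    · refine Finset.sum_congr rfl fun i _ => ?_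
      rw [Pi.smul_apply, basisVec, Pi.single_apply, Pi.single_apply]
      split_ifs
      · rfl
      · rw [map_zero]
    · rw [← Finset.sum_subset (Finset.subset_univ Iᶜ)]
      · refine Finset.sum_congr rfl fun i hi => ?_
        rw [Finset.mem_compl] at hi
        rw [Pi.smul_apply, Pi.smul_apply, basisVec, basisVec, Pi.single_apply, Pi.single_apply]
        simp only [Nat.add_right_cancel_iff]
        split_ifs
        · rw [hw, if_neg hi]
        · rw [map_zero, smul_zero (sgn i I)]
      · intro i _ hi
        rw [Finset.mem_compl, not_not] at hi
        rw [basisVec, Pi.single_apply]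
        split_ifs
        · rw [hw, if_pos hi, smul_zero]
        · rw [map_zero, smul_zero]
  rw [hd, map_add, map_sum, map_sum, Finset.sum_eq_zero, zero_add]
  · refine Finset.sum_congr rfl fun i _ => ?_
    rw [map_smul, map_zsmul, Algebra.smul_def]
  · intro i _
    rw [map_smul, Algebra.smul_def, T.algebraMap_z, zero_mul]

theorem map_d_basisVec_zero (β : Tot n B →ₗ[B] A) (I : Finset (Fin n)) :
    β (T.d (basisVec 0 I)) = 0 := by
  have hd : T.d (basisVec 0 I) =
      ∑ i, T.z i • (Pi.single 0 (contr i (Pi.single I 1)) : Tot n B) := by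
    ext l : 1
    have h0 : basisVec (B := B) 0 I (l + 1) = 0 := by simp [basisVec]
    rw [d_apply, h0, map_zero, add_zero, koszulD_apply, Finset.sum_apply]
    refine Finset.sum_congr rfl fun i _ => ?_
    rw [Pi.smul_apply, basisVec, Pi.single_apply, Pi.single_apply]
    split_ifs
    · rfl
    · rw [map_zero]
  rw [hd, map_sum]
  refine Finset.sum_eq_zero fun i _ => ?_
  rw [map_smul, Algebra.smul_def, T.algebraMap_z, zero_mul]

end TateData

namespace HypersurfaceData

variable (D : HypersurfaceData (B := B) x)

theorem isSolution (hx : ∏ i, x i = 0) : IsSolution (fun i => D.hhOp (D.mulOp (D.y i)))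
    (fun i => D.hhOp (D.yOp i)) (D.hhOp D.shiftOp) where
  X_comm_X _ _ := hhOp_mulOp_comm _ _
  X_comm_Y _ _ := hhOp_mulOp_comm _ _
  X_comm_Z _ := hhOp_mulOp_comm _ _
  Y_comm_Z := D.yOp_shiftOp_comm
  Y_anticomm := D.yOp_anticomm hx
  Y_sq := D.yOp_sq hx
  monomial := D.prod_ofFn_eq_zero hx
  boundary _ := D.boundary_eq_zero hx

section monomialCochain

variable (k : Type u) [Field k] [Algebra k A]

/-- The cocycle which represents the class `p Y_I Z^j`. -/
abbrev monomialCochain (p : MvPolynomial (Fin n) k) (I : Finset (Fin n)) (j : ℕ) :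
    Tot n B →ₗ[B] A :=
  cochain (MvPolynomial.aeval x p * (prodSign I.card * ∏ i ∈ I, x i)) (I.sort (· ≤ ·)) j

theorem monomialCochain_apply (p : MvPolynomial (Fin n) k) (I : Finset (Fin n)) (j : ℕ)
    (c : Tot n B) : monomialCochain (x := x) k p I j c =
      MvPolynomial.aeval x p * (prodSign I.card * ∏ i ∈ I, x i) * algebraMap B A (c j I) := by
  rw [cochain_apply, coord_of_pairwise (Finset.sortedLT_sort I).pairwise, Finset.sort_toFinset]

theorem monomialCochain_isCocycle (hx : ∏ i, x i = 0) (p : MvPolynomial (Fin n) k)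
    (I : Finset (Fin n)) (j m : ℕ) :
    D.IsCocycle m (monomialCochain (x := x) k p I j) := by
  refine cochain_isCocycle (fun i hi => ?_) _ _
  rw [← listProd_sort, mul_assoc, mul_assoc, D.listProd_mul_g hx hi, mul_zero, mul_zero]

end monomialCochain

variable (k : Type u) [Field k] [Algebra k B]

/-- The homomorphism from the presented algebra to the Yoneda algebra. -/
def comparison (hx : ∏ i, x i = 0) : PresentedAlgebra k n →ₐ[k]
    ⨁ m, Ext.{u} (ModuleCat.of B A) (ModuleCat.of B A) m := (D.isSolution hx).lift

/-- The homomorphism from the polynomial ring to the presented algebra. -/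
abbrev polyGen : MvPolynomial (Fin n) k →ₐ[k] PresentedAlgebra k n :=
  polyHom (gen_X_mem_center (n := n) k)

variable [Algebra k A] [IsScalarTower k B A] (hx : ∏ i, x i = 0)

theorem comparison_polyHom_mul {m : ℕ} {γ : Tot n B →ₗ[B] A} (h : D.IsCocycle m γ)
    (p : MvPolynomial (Fin n) k) : D.comparison k hx (polyGen k p) * D.hh m γ =
      D.hh m (MvPolynomial.aeval x p • γ) := by
  induction p using MvPolynomial.induction_on generalizing γ with
  | C a =>
    rw [← MvPolynomial.algebraMap_eq, AlgHom.commutes, AlgHom.commutes, AlgHom.commutes,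
      ← Algebra.smul_def, ← hh_smul h]
    congr 1
    ext c
    rw [LinearMap.smul_apply, LinearMap.smul_apply, smul_eq_mul, Algebra.smul_def,
      ← IsScalarTower.algebraMap_apply]
  | add p q hp hq =>
    rw [map_add, map_add, add_mul, hp h, hq h, ← hh_add (h.smul _) (h.smul _), map_add]
    congr 1
    ext c
    simp only [LinearMap.add_apply, LinearMap.smul_apply, smul_eq_mul, add_mul]
  | mul_X p i hp =>
    have hX : D.comparison k hx (gen k (Gen.X i)) = D.hhOp (D.mulOp (D.y i)) :=
      (D.isSolution hx).lift_gen (k := k) (Gen.X i)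
    rw [map_mul, map_mul, polyHom_X, hX, mul_assoc, hhOp_mulOp_mul_hh _ h, hp (h.smul _),
      D.algebraMap_y, smul_smul, map_mul,
      MvPolynomial.aeval_X]

theorem comparison_monomial (p : MvPolynomial (Fin n) k) (I : Finset (Fin n)) (j : ℕ) :
    D.comparison k hx (polyGen k p * setProd (fun i => gen k (Gen.Y i)) I * gen k Gen.Z ^ j) =
      D.hh (I.card + 2 * j) (monomialCochain (x := x) k p I j) := by
  have h := D.prod_yOp hx (I.sort (· ≤ ·)) j
  rw [Finset.length_sort, listProd_sort] at h
  have hY : D.comparison k hx (setProd (fun i => gen k (Gen.Y i)) I) =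
      ((I.sort (· ≤ ·)).map fun i => D.hhOp (D.yOp i)).prod := by
    rw [setProd, map_list_prod, List.map_map]
    exact congrArg List.prod (List.map_congr_left fun i _ =>
      (D.isSolution hx).lift_gen (k := k) (Gen.Y i))
  have hZ : D.comparison k hx (gen k Gen.Z) = D.hhOp D.shiftOp :=
    (D.isSolution hx).lift_gen (k := k) Gen.Z
  rw [map_mul, map_mul, map_pow, hY, hZ, mul_assoc, h, comparison_polyHom_mul, smul_cochain]
  refine cochain_isCocycle (fun i hi => ?_) _ _
  rw [← listProd_sort, mul_assoc, D.listProd_mul_g hx hi, mul_zero]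

end HypersurfaceData

end Koszul

/-! ### The comparison map is an isomorphism of graded algebras -/

namespace HHPresentation

open Koszul

variable {n : ℕ} (k : Type u) [Field k]

theorem mem_component_of_word (w : List (Gen n)) :
    (w.map (gen k)).prod ∈ PresentedAlgebra.component k n (w.map Gen.deg).sum := by
  refine Submodule.subset_span ⟨w, rfl, ?_⟩
  rw [map_list_prod, List.map_map]
  rfl

theorem gen_mul_mem_component (g : Gen n) {m : ℕ} {r : PresentedAlgebra k n}
    (hr : r ∈ PresentedAlgebra.component k n m) :
    gen k g * r ∈ PresentedAlgebra.component k n (g.deg + m) := by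
  induction hr using Submodule.span_induction with
  | mem r hr =>
    obtain ⟨w, rfl, rfl⟩ := hr
    have := mem_component_of_word k (g :: w)
    rw [List.map_cons, List.map_cons, List.prod_cons, List.sum_cons] at this
    rwa [map_list_prod, List.map_map]
  | zero => rw [mul_zero]; exact zero_mem _
  | add a b _ _ ha hb => rw [mul_add]; exact add_mem ha hb
  | smul c a _ ha => rw [mul_smul_comm]; exact Submodule.smul_mem _ c ha

theorem monomial_mem_component (p : MvPolynomial (Fin n) k) (I : Finset (Fin n)) (j : ℕ) :
    polyHom (gen_X_mem_center k) p * setProd (fun i => gen k (Gen.Y i)) I * gen k Gen.Z ^ j ∈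
      PresentedAlgebra.component k n (I.card + 2 * j) := by
  rw [mul_assoc]
  have hr : setProd (fun i => gen k (Gen.Y i)) I * gen k Gen.Z ^ j ∈
      PresentedAlgebra.component k n (I.card + 2 * j) := by
    have h := mem_component_of_word k ((I.sort (· ≤ ·)).map Gen.Y ++ List.replicate j Gen.Z)
    simpa [List.map_map, Function.comp_def, Gen.deg, mul_comm j 2, setProd] using h
  generalize setProd (fun i => gen k (Gen.Y i)) I * gen k Gen.Z ^ j = r at hr ⊢
  induction p using MvPolynomial.induction_on generalizing r with
  | C a =>
    rw [← MvPolynomial.algebraMap_eq, AlgHom.commutes, ← Algebra.smul_def]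
    exact Submodule.smul_mem _ _ hr
  | add p q hp hq => rw [map_add, add_mul]; exact add_mem (hp r hr) (hq r hr)
  | mul_X p i hp =>
    rw [map_mul, polyHom_X, mul_assoc]
    refine hp _ ?_
    have := gen_mul_mem_component k (Gen.X i) hr
    rwa [Gen.deg, zero_add] at this

/-- A normal form vanishes if all its coefficients have image zero after multiplication by `x_I`. -/
theorem normalForm_eq_zero_of_aeval_eq_zero {A : Type u} [CommRing A] [Algebra k A]
    {x : Fin n → A} (H : IsSquareFreeHypersurface k x) {L : ℕ}
    {τ : ℕ → Finset (Fin n) → MvPolynomial (Fin n) k}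
    (h : ∀ j < L, ∀ I, MvPolynomial.aeval x (τ j I) * ∏ i ∈ I, x i = 0) :
    normalForm (gen_X_mem_center k) (fun i => gen k (Gen.Y i)) (gen k Gen.Z) L τ = 0 := by
  refine Finset.sum_eq_zero fun j hj => Finset.sum_eq_zero fun I _ => ?_
  obtain ⟨q, hq⟩ := H.dvd_of_mul_eq_zero (h j (Finset.mem_range.mp hj) I)
  rw [hq, mul_comm, map_mul, mul_assoc (polyHom _ q),
    polyHom_compl_mul_setProd _ (isSolution_gen k), mul_zero, zero_mul]

/-- The coefficients, in degree `j` of the variable `Z`, of a combination of the boundary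
relations. -/
def boundaryCoeff (b : ℕ → Finset (Fin n) → MvPolynomial (Fin n) k) (j : ℕ)
    (I : Finset (Fin n)) : MvPolynomial (Fin n) k :=
  match j with
  | 0 => 0
  | j + 1 => ∑ i ∈ Iᶜ, sgn i I • ((∏ i' ∈ (insert i I)ᶜ, MvPolynomial.X i') * b j (insert i I))

theorem normalForm_boundaryCoeff (L : ℕ) (b : ℕ → Finset (Fin n) → MvPolynomial (Fin n) k) :
    normalForm (gen_X_mem_center k) (fun i => gen k (Gen.Y i)) (gen k Gen.Z) L
      (boundaryCoeff k b) = 0 := by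
  refine Finset.sum_eq_zero fun j _ => ?_
  cases j with
  | zero => simp [boundaryCoeff]
  | succ j =>
    have h1 : ∀ I, polyHom (gen_X_mem_center k) (boundaryCoeff k b (j + 1) I) *
        setProd (fun i => gen k (Gen.Y i)) I * gen k Gen.Z ^ (j + 1) =
        ∑ i ∈ Iᶜ, polyHom (gen_X_mem_center k) (b j (insert i I)) *
          (polyHom (gen_X_mem_center k) (∏ i' ∈ (insert i I)ᶜ, MvPolynomial.X i') *
            (sgn i (insert i I) • setProd (fun i => gen k (Gen.Y i)) ((insert i I).erase i)) *
              gen k Gen.Z) * gen k Gen.Z ^ j := by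
      intro I
      rw [boundaryCoeff, map_sum, Finset.sum_mul, Finset.sum_mul]
      refine Finset.sum_congr rfl fun i hi => ?_
      rw [Finset.erase_insert (Finset.mem_compl.mp hi), sgn_insert_self, map_zsmul, mul_comm,
        map_mul, pow_succ']
      simp only [smul_mul_assoc, mul_smul_comm, mul_assoc]
    have h2 : ∀ J : Finset (Fin n), ∑ i ∈ J, polyHom (gen_X_mem_center k) (b j J) *
          (polyHom (gen_X_mem_center k) (∏ i' ∈ Jᶜ, MvPolynomial.X i') *
            (sgn i J • setProd (fun i => gen k (Gen.Y i)) (J.erase i)) *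
              gen k Gen.Z) * gen k Gen.Z ^ j = 0 := by
      intro J
      rcases J.eq_empty_or_nonempty with rfl | hJ
      · rw [Finset.sum_empty]
      · rw [← Finset.sum_mul, ← Finset.mul_sum, ← Finset.sum_mul, ← Finset.mul_sum,
          boundary_sgn _ (isSolution_gen k) hJ, mul_zero, zero_mul]
    rw [Finset.sum_congr rfl fun I _ => h1 I,
      ← Finset.sum_eq_zero (s := Finset.univ) fun J _ => h2 J,
      Finset.sum_sigma', Finset.sum_sigma']
    refine Finset.sum_bij' (fun q _ => ⟨insert q.2 q.1, q.2⟩) (fun q _ => ⟨q.1.erase q.2, q.2⟩)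
      ?_ ?_ ?_ ?_ ?_
    · rintro ⟨I, i⟩ _
      simp
    · rintro ⟨J, i⟩ _
      simp
    · rintro ⟨I, i⟩ h
      simp only [Finset.mem_sigma, Finset.mem_univ, true_and, Finset.mem_compl] at h
      simp [h]
    · rintro ⟨J, i⟩ h
      simp only [Finset.mem_sigma, Finset.mem_univ, true_and] at h
      simp [Finset.insert_erase h]
    · rintro ⟨I, i⟩ _
      rfl

end HHPresentation

namespace Koszul

open HHPresentation TateData

variable {n : ℕ} {B A : Type u} [CommRing B] [CommRing A] [Algebra B A] {x : Fin n → A}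

namespace HypersurfaceData

variable (D : HypersurfaceData (B := B) x)

/-- The coefficient of a cocycle at `e_J t^(j)` is a multiple of `x_J`. The cocycle condition at
`e_{J ∖ i} t^(j + 1)` is considered modulo `x_i`, for each `i ∈ J`. -/
theorem exists_coeff_eq (k : Type u) [Field k] [Algebra k A] (H : IsSquareFreeHypersurface k x)
    {m : ℕ} {γ : Tot n B →ₗ[B] A}
    (h : D.IsCocycle m γ) (j : ℕ) (J : Finset (Fin n)) (hJ : J.card + 2 * j = m) :
    ∃ p : MvPolynomial (Fin n) k, γ (basisVec j J) =
      MvPolynomial.aeval x p * (prodSign J.card * ∏ i ∈ J, x i) := by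
  have h1 : ∀ i ∈ J, x i ∣ (∏ j ∈ Finset.univ.erase i, x j) * γ (basisVec j J) := by
    intro i hi
    have hc := Finset.card_erase_add_one hi
    have h0 := h (basisVec (j + 1) (J.erase i)) (by
      have := basisVec_mem (B := B) (j + 1) (J.erase i)
      rwa [show (J.erase i).card + 2 * (j + 1) = m + 1 by lia] at this)
    have hi' : i ∈ (J.erase i)ᶜ := by simp
    rw [map_d_basisVec, ← Finset.add_sum_erase _ _ hi', Finset.insert_erase hi,
      D.algebraMap_g] at h0
    have hs : x i ∣ sgn i (J.erase i) • ((∏ j ∈ Finset.univ.erase i, x j) * γ (basisVec j J)) := by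
      rw [← mul_smul_comm, eq_neg_of_add_eq_zero_left h0, dvd_neg]
      refine Finset.dvd_sum fun i' hi' => ?_
      rw [D.algebraMap_g]
      refine Dvd.dvd.mul_right (Finset.dvd_prod_of_mem _ ?_) _
      exact Finset.mem_erase.mpr ⟨(Finset.mem_erase.mp hi').1.symm, Finset.mem_univ _⟩
    obtain ⟨b, hb⟩ := hs
    refine ⟨sgn i (J.erase i) • b, ?_⟩
    rw [mul_smul_comm, ← hb, smul_smul, sgn_mul_self, one_smul]
  obtain ⟨p, hp⟩ := H.exists_eq_mul h1
  refine ⟨MvPolynomial.C ((prodSign J.card : ℤ) : k) * p, ?_⟩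
  have hs := congrArg (Int.cast : ℤ → A) (prodSign_mul_self J.card)
  push_cast at hs
  rw [hp, map_mul, MvPolynomial.aeval_C, map_intCast]
  linear_combination (-MvPolynomial.aeval x p * ∏ i ∈ J, x i) * hs

variable (k : Type u) [Field k] [Algebra k B]

theorem comparison_mem_of_mem_component (hx : ∏ i, x i = 0) {m : ℕ} {r : PresentedAlgebra k n}
    (hr : r ∈ PresentedAlgebra.component k n m) : D.comparison k hx r ∈ LinearMap.range
      (DirectSum.lof k ℕ (fun m => Ext.{u} (ModuleCat.of B A) (ModuleCat.of B A) m) m) := by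
  induction hr using Submodule.span_induction with
  | mem r hr =>
    obtain ⟨w, rfl, rfl⟩ := hr
    rw [map_list_prod, map_list_prod, List.map_map, List.map_map]
    induction w with
    | nil => exact ⟨GradedMonoid.GOne.one, rfl⟩
    | cons g w ih =>
      obtain ⟨α, hα⟩ := ih
      have hg : D.comparison k hx (gen k g) ∈ LinearMap.range
          (DirectSum.lof k ℕ (fun m => Ext.{u} (ModuleCat.of B A) (ModuleCat.of B A) m) g.deg) := by
        rw [comparison, IsSolution.lift_gen]
        cases g with
        | X i => exact ⟨_, rfl⟩
        | Y i => exact ⟨_, rfl⟩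
        | Z => exact ⟨_, rfl⟩
      obtain ⟨β, hβ⟩ := hg
      refine ⟨GradedMonoid.GMul.mul β α, ?_⟩
      refine Eq.trans ?_ ((congrArg₂ (· * ·) hβ hα).trans List.prod_cons.symm)
      exact (DirectSum.of_mul_of _ _).symm
  | zero => rw [map_zero]; exact zero_mem _
  | add a b _ _ ha hb => rw [map_add]; exact add_mem ha hb
  | smul c a _ ha => rw [map_smul]; exact Submodule.smul_mem _ c ha

variable [Algebra k A] [IsScalarTower k B A] (H : IsSquareFreeHypersurface k x)

/-- Every class of degree `m` is the image of an element of degree `m` of the presented algebra. -/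
theorem exists_comparison_eq {m : ℕ} (α : Ext.{u} (ModuleCat.of B A) (ModuleCat.of B A) m) :
    ∃ r ∈ PresentedAlgebra.component k n m, D.comparison k H.prod_eq_zero r =
      DirectSum.of (fun m => Ext.{u} (ModuleCat.of B A) (ModuleCat.of B A) m) m α := by
  obtain ⟨γ, h, rfl⟩ := D.exists_cocycleClass_eq α
  choose p hp using D.exists_coeff_eq k H h
  let s : Finset (ℕ × Finset (Fin n)) :=
    (Finset.range (m + 1) ×ˢ Finset.univ).filter fun q => q.2.card + 2 * q.1 = m
  let P : ℕ × Finset (Fin n) → MvPolynomial (Fin n) k := fun q =>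
    if hq : q.2.card + 2 * q.1 = m then p q.1 q.2 hq else 0
  refine ⟨∑ q ∈ s, polyGen k (P q) * setProd (fun i => gen k (Gen.Y i)) q.2 * gen k Gen.Z ^ q.1,
    Submodule.sum_mem _ fun q hq => ?_, ?_⟩
  · have := monomial_mem_component k (P q) q.2 q.1
    rwa [(Finset.mem_filter.mp hq).2] at this
  · rw [map_sum, ← classOf_eq h]
    change _ = D.hh m γ
    have hco : ∀ q ∈ s, D.IsCocycle m (monomialCochain (x := x) k (P q) q.2 q.1) := fun q _ =>
      D.monomialCochain_isCocycle k H.prod_eq_zero _ _ _ _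
    trans D.hh m (∑ q ∈ s, monomialCochain (x := x) k (P q) q.2 q.1)
    · rw [hh_sum _ _ hco]
      refine Finset.sum_congr rfl fun q hq => ?_
      rw [comparison_monomial, (Finset.mem_filter.mp hq).2]
    · refine hh_congr rfl (IsCocycle.sum _ _ hco) h fun c hc => ?_
      conv_rhs => rw [eq_sum_basisVec hc m.lt_succ_self]
      rw [← Finset.sum_product', map_sum, LinearMap.sum_apply]
      refine Finset.sum_subset_zero_on_sdiff (Finset.filter_subset _ _) (fun q hq => ?_)
        fun q hq => ?_
      · have : q.2.card + 2 * q.1 ≠ m := fun hm =>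
          (Finset.mem_sdiff.mp hq).2 (Finset.mem_filter.mpr ⟨(Finset.mem_sdiff.mp hq).1, hm⟩)
        rw [hc q.1 q.2 this, zero_smul, map_zero]
      · rw [monomialCochain_apply, map_smul, Algebra.smul_def]
        have hq' := (Finset.mem_filter.mp hq).2
        simp only [P, dif_pos hq']
        rw [hp, mul_comm]

/-- The component of degree `m` of the image of a normal form is the class of the sum of all the
cocycles, including those of the other degrees, which vanish in degree `m`. -/
theorem comparison_normalForm_component (L : ℕ) (τ : ℕ → Finset (Fin n) → MvPolynomial (Fin n) k)
    (m : ℕ) : (D.comparison k H.prod_eq_zero (normalForm (gen_X_mem_center k)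
      (fun i => gen k (Gen.Y i)) (gen k Gen.Z) L τ)) m =
        D.classOf m (∑ j ∈ Finset.range L, ∑ I, monomialCochain (x := x) k (τ j I) I j) := by
  have hc := D.monomialCochain_isCocycle k H.prod_eq_zero
  rw [normalForm, map_sum, DFinsupp.finsetSum_apply, classOf_sum _ _ fun j _ =>
    IsCocycle.sum _ _ fun I _ => hc _ _ _ _]
  refine Finset.sum_congr rfl fun j _ => ?_
  rw [map_sum, DFinsupp.finsetSum_apply, classOf_sum _ _ fun I _ => hc _ _ _ _]
  refine Finset.sum_congr rfl fun I _ => ?_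
  rw [comparison_monomial, hh]
  by_cases hm : I.card + 2 * j = m
  · subst hm
    exact DirectSum.of_eq_same _ _
  · rw [DirectSum.of_eq_of_ne _ _ _ (Ne.symm hm), ← classOf_zero (T := D.toTateData)]
    refine classOf_congr isCocycle_zero (hc _ _ _ _) fun c hc => ?_
    rw [monomialCochain_apply, hc j I hm, map_zero, mul_zero, LinearMap.zero_apply]

theorem comparison_injective : Function.Injective (D.comparison k H.prod_eq_zero) := by
  rw [injective_iff_map_eq_zero]
  intro r hr
  have hgen : Set.range (Gen.elim (fun i : Fin n => gen k (Gen.X i)) (fun i => gen k (Gen.Y i))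
      (gen k Gen.Z)) = Set.range (gen k) := by
    congr 1
    ext g
    cases g <;> rfl
  obtain ⟨L, τ, rfl⟩ := exists_normalForm (gen_X_mem_center k) (isSolution_gen (n := n) k)
    (by rw [hgen, adjoin_range_gen]) r
  set γ : Tot n B →ₗ[B] A :=
    ∑ j ∈ Finset.range L, ∑ I, monomialCochain (x := x) k (τ j I) I j with hγ
  have hco : ∀ m, D.IsCocycle m γ := fun m => IsCocycle.sum _ _ fun j _ =>
    IsCocycle.sum _ _ fun I _ => D.monomialCochain_isCocycle k H.prod_eq_zero _ _ _ _
  have hcls : ∀ m, D.cocycleClass (hco m) = 0 := fun m => by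
    rw [← classOf_eq, hγ, ← D.comparison_normalForm_component k H, hr, DirectSum.zero_apply]
  have hval : ∀ j < L, ∀ I, γ (basisVec j I) =
      MvPolynomial.aeval x (τ j I) * (prodSign I.card * ∏ i ∈ I, x i) := by
    intro j hj I
    rw [hγ, LinearMap.sum_apply, Finset.sum_eq_single j, LinearMap.sum_apply,
      Finset.sum_eq_single I, monomialCochain_apply, basisVec_apply, if_pos ⟨rfl, rfl⟩, map_one,
      mul_one]
    · intro I' _ hI'
      rw [monomialCochain_apply, basisVec_apply, if_neg fun h => hI' h.2, map_zero, mul_zero]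
    · simp
    · intro j' _ hj'
      rw [LinearMap.sum_apply]
      refine Finset.sum_eq_zero fun I' _ => ?_
      rw [monomialCochain_apply, basisVec_apply, if_neg fun h => hj' h.1, map_zero, mul_zero]
    · exact fun h => absurd (Finset.mem_range.mpr hj) h
  choose β hβ using fun m => exists_of_cocycleClass_eq_zero (hco (m + 1)) (hcls (m + 1))
  -- The sign is the one which `Y_{J ∖ i}` contributes, where `J ∖ i` has one element less than `J`.
  choose b hb using fun (j : ℕ) (J : Finset (Fin n)) => H.surjective
    (prodSign (J.card - 1) * β (J.card + 2 * j) (basisVec j J))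
  have hdiff := normalForm_eq_zero_of_aeval_eq_zero k H (L := L) (τ := τ - boundaryCoeff k b) ?_
  · rwa [normalForm_sub, normalForm_boundaryCoeff k, sub_zero] at hdiff
  intro j hj I
  have hsign := congrArg (Int.cast : ℤ → A) (prodSign_mul_self I.card)
  push_cast at hsign
  cases j with
  | zero =>
    have h0 : γ (basisVec 0 I) = 0 := by
      rcases hI : I.card with _ | p
      · exact eq_zero_of_cocycleClass_eq_zero (hco 0) (hcls 0) _ (by
          simpa [hI] using basisVec_mem (B := B) 0 I)
      · rw [hβ p _ (by simpa [hI] using basisVec_mem (B := B) 0 I), map_d_basisVec_zero]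
    rw [hval 0 hj] at h0
    rw [Pi.sub_apply, Pi.sub_apply, boundaryCoeff, sub_zero]
    linear_combination (prodSign I.card : A) * h0 -
      MvPolynomial.aeval x (τ 0 I) * (∏ i ∈ I, x i) * hsign
  | succ j =>
    have h1 := hβ (I.card + 1 + 2 * j) (basisVec (j + 1) I) (by
      have := basisVec_mem (B := B) (j + 1) I
      rwa [show I.card + 2 * (j + 1) = I.card + 1 + 2 * j + 1 by lia] at this)
    rw [hval _ hj, map_d_basisVec] at h1
    have h2 : MvPolynomial.aeval x (boundaryCoeff k b (j + 1) I) * ∏ i ∈ I, x i =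
        prodSign I.card * ∑ i ∈ Iᶜ, algebraMap B A (D.g i) *
          (sgn i I • β (I.card + 1 + 2 * j) (basisVec j (insert i I))) := by
      rw [boundaryCoeff, map_sum, Finset.sum_mul, Finset.mul_sum]
      refine Finset.sum_congr rfl fun i hi => ?_
      have hi' := Finset.mem_compl.mp hi
      rw [map_zsmul, map_mul, hb, Finset.card_insert_of_notMem hi', Nat.add_sub_cancel,
        D.algebraMap_g, ← prod_compl_mul_prod_erase (Finset.mem_insert_self i I),
        Finset.erase_insert hi', map_prod, zsmul_eq_mul, zsmul_eq_mul]
      simp only [MvPolynomial.aeval_X]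
      ring
    rw [Pi.sub_apply, Pi.sub_apply, map_sub, sub_mul]
    linear_combination (prodSign I.card : A) * h1 - h2 -
      MvPolynomial.aeval x (τ (j + 1) I) * (∏ i ∈ I, x i) * hsign

theorem comparison_surjective : Function.Surjective (D.comparison k H.prod_eq_zero) := by
  intro y
  induction y using DirectSum.induction_on with
  | zero => exact ⟨0, map_zero _⟩
  | of m α =>
    obtain ⟨r, _, hr⟩ := D.exists_comparison_eq k H α
    exact ⟨r, hr⟩
  | add y z hy hz =>
    obtain ⟨r, rfl⟩ := hy
    obtain ⟨s, rfl⟩ := hz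
    exact ⟨r + s, map_add _ _ _⟩

/-- The isomorphism from the Yoneda algebra to the presented algebra, inverse to `comparison`. -/
def comparisonEquiv : (⨁ m, Ext.{u} (ModuleCat.of B A) (ModuleCat.of B A) m) ≃ₐ[k]
    PresentedAlgebra k n :=
  (AlgEquiv.ofBijective (D.comparison k H.prod_eq_zero)
    ⟨D.comparison_injective k H, D.comparison_surjective k H⟩).symm

theorem map_comparisonEquiv (m : ℕ) : (LinearMap.range (DirectSum.lof k ℕ
    (fun m => Ext.{u} (ModuleCat.of B A) (ModuleCat.of B A) m) m)).map
      (D.comparisonEquiv k H).toLinearMap = PresentedAlgebra.component k n m := by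
  have hΦ : ∀ r, (D.comparisonEquiv k H) (D.comparison k H.prod_eq_zero r) = r := fun r =>
    AlgEquiv.symm_apply_apply (AlgEquiv.ofBijective (D.comparison k H.prod_eq_zero)
      ⟨D.comparison_injective k H, D.comparison_surjective k H⟩) r
  apply le_antisymm
  · rintro _ ⟨_, ⟨α, rfl⟩, rfl⟩
    obtain ⟨r, hr, hα⟩ := D.exists_comparison_eq k H α
    have h : (D.comparisonEquiv k H) (DirectSum.of
      (fun m => Ext.{u} (ModuleCat.of B A) (ModuleCat.of B A) m) m α) = r := by rw [← hα, hΦ]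
    exact h.symm ▸ hr
  · intro r hr
    exact ⟨_, D.comparison_mem_of_mem_component k H.prod_eq_zero hr, hΦ r⟩

end HypersurfaceData

theorem isSquareFreeHypersurface_mk (k : Type u) [Field k] (n : ℕ) :
    IsSquareFreeHypersurface k (A := SquareFreeHypersurface k n)
      (fun i => Ideal.Quotient.mk _ (MvPolynomial.X i)) := by
  have h : MvPolynomial.aeval (R := k) (S₁ := SquareFreeHypersurface k n)
      (fun i => Ideal.Quotient.mk _ (MvPolynomial.X i)) = Ideal.Quotient.mkₐ k _ := by
    ext i
    simp
  constructor
  · rw [h]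
    exact Ideal.Quotient.mkₐ_surjective k _
  · intro p
    rw [h, ← Ideal.mem_span_singleton]
    exact Ideal.Quotient.eq_zero_iff_mem

end Koszul

end

/-- For `A = k[x₁, …, xₙ] / (x₁ ⋯ xₙ)`, the Hochschild cohomology ring of `A` is isomorphic, as a
graded `k`-algebra, to the presented algebra. -/
theorem theorem5p1 (k : Type u) [Field k] (n : ℕ) :
    ∃ φ : HochschildCohomologyRing k (SquareFreeHypersurface k n) ≃ₐ[k]
        HHPresentation.PresentedAlgebra k n,
      ∀ m : ℕ,
        (HochschildCohomologyRing.component k (SquareFreeHypersurface k n) m).map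
            φ.toLinearMap =
          HHPresentation.PresentedAlgebra.component k n m := by
  have H := Koszul.isSquareFreeHypersurface_mk k n
  let := Koszul.envelopeAlgebra k (SquareFreeHypersurface k n)
  have := Koszul.isScalarTower_envelope k (SquareFreeHypersurface k n)
  exact ⟨(Koszul.envelopeData H).comparisonEquiv k H,
    (Koszul.envelopeData H).map_comparisonEquiv k H⟩
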